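/- Let $\Theta\subset\mathbb R^p$ and $B\subset\mathbb R^L$ be compact and let $F_\theta:[-\pi,\pi]^2\to(0,\infty)$, $\theta\in\Theta$, be a family of spectral densities on the lattice $\mathbb Z^2$. Write $\gamma_{h,k}(F)=\frac1{4\pi^2}\int_{[-\pi,\pi]^2}F(\lambda)\,e^{i(h\lambda_1+k\lambda_2)}\,d\lambda$, and let $\Sigma_N(F)$ be the $N^2\times N^2$ matrix, indexed by the sites $(r,s)\in\{1,\dots,N\}^2$, with entries $\gamma_{r-r',\,s-s'}(F)$. Let $\mathcal S$ be the class of functions $F$ on $[-\pi,\pi]^2$ with $F(\lambda)=\sum_{h,k\in\mathbb Z}\gamma_{h,k}e^{-i(h\lambda_1+k\lambda_2)}$ for real coefficients $\gamma_{h,k}=\gamma_{-h,-k}$ such that $\sum_k|k||\gamma_{h,k}|<\infty$ for all $h$, $\sum_h|h||\gamma_{h,k}|<\infty$ for all $k$, and $\sum_{h,k}|h||k||\gamma_{h,k}|<\infty$. Assume (A2): $F_\theta(\lambda)$ is twice continuously differentiable in $\theta\in\Theta$, with $F_\theta$, $\nabla_\theta F_\theta$ and $\nabla_\theta\nabla_\theta'F_\theta$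 continuous in $(\theta,\lambda)\in\Theta\times[-\pi,\pi]^2$; $F_\theta(\lambda)$ is bounded above and bounded away from zero uniformly in $(\theta,\lambda)$; and $F_\theta$ and all components of $\nabla_\theta F_\theta$ and $\nabla_\theta\nabla_\theta'F_\theta$ belong to $\mathcal S$ for every $\theta\in\Theta$. Assume that the model is identifiable: for $\theta_1,\theta_2\in\Theta$, $F_{\theta_1}=F_{\theta_2}$ implies $\theta_1=\theta_2$. Let $X_1,\dots,X_L:\mathbb Z^2\to\mathbb R$ be regressors, and let $\{Y_{r,s}\}_{(r,s)\in\mathbb Z^2}$ be a Gaussian random field with $\mathbb E\,Y_{r,s}=\sum_{\ell=1}^L\tilde\beta_\ell X_\ell(r,s)$ and $\mathrm{Cov}(Y_{r,s},Y_{a,b})=\gamma_{a-r,\,b-s}(F_{\tilde\theta})$, where $\tilde\theta\in\operatorname{int}\Theta$ and $\tilde\beta\in\operatorname{int}B$ (so that the model and the regressors are correctly specified). Let $Y$ be the vector of the observations at the sites of $\{1,\dots,N\}^2$ and $X$ the $N^2\times L$ matrix with entries $X_\ell(r,s)$. Assume that for every $\theta\in\Theta$ $$N^{-2}X'\Sigma_N^{-1}(F_\theta)X\to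 M(\theta)\qquad(N\to\infty),$$ where $M(\theta)$ is positive definite with eigenvalues bounded away from $0$ and $\infty$ uniformly in $\theta\in\Theta$. Let the prior $\pi$ be a fixed probability measure on $\Theta\times B$ that gives positive mass to every neighbourhood of $(\tilde\theta,\tilde\beta)$, and let $\hat\theta_B$ and $\hat\beta_B$ be the posterior means of $\theta$ and $\beta$ given $Y$, for the posterior proportional to $e^{\mathcal L(\theta,\beta)}\,\pi(d\theta,d\beta)$ with the Gaussian log likelihood $$\mathcal L(\theta,\beta)=-\tfrac12\log|\Sigma_N(F_\theta)|-\tfrac12(Y-X\beta)'\Sigma_N^{-1}(F_\theta)(Y-X\beta).$$ Then $\hat\beta_B\to\tilde\beta$ and $\hat\theta_B\to\tilde\theta$ in probability as $N\to\infty$. -/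

import Mathlib

open MeasureTheory ProbabilityTheory Filter Topology

noncomputable section

namespace LatticeField

/-- The square `[-π, π]²` of frequencies. -/
def freqBox : Set (ℝ × ℝ) := Set.Icc (-Real.pi) Real.pi ×ˢ Set.Icc (-Real.pi) Real.pi

/-- The character `Z₁^h Z₂^k` with `Z_j = exp (-i w_j)`, at the lag `t = (h, k)`. -/
def zmon (t : ℤ × ℤ) (w : ℝ × ℝ) : ℂ :=
  Complex.exp (-Complex.I * ((t.1 : ℂ) * (w.1 : ℂ) + (t.2 : ℂ) * (w.2 : ℂ)))

/-- The autocovariance `γ_t(F) = (4π²)⁻¹ ∫∫ F(w) Z₁^{-h} Z₂^{-k} dw` at the lag `t = (h, k)`.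
For a spectrum with `F(w) = F(-w)` the integral is real; its real part is the value. -/
def acf (F : ℝ × ℝ → ℝ) (t : ℤ × ℤ) : ℝ :=
  ((4 * (Real.pi : ℂ) ^ 2)⁻¹ * ∫ w in freqBox, (F w : ℂ) * zmon (-t) w).re

/-- `F` is the Fourier series of its (real, even) coefficients `γ_{h,k}`, for which the sums
`∑_k |k| |γ_{h,k}|`, `∑_h |h| |γ_{h,k}|` and `∑_{h,k} |h| |k| |γ_{h,k}|` are finite. -/
structure SummableSpectrum (F : ℝ × ℝ → ℝ) : Prop where
  hasSum : ∀ w ∈ freqBox, HasSum (fun t : ℤ × ℤ => (acf F t : ℂ) * zmon t w) (F w : ℂ)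
  row : ∀ h : ℤ, Summable fun k : ℤ => |(k : ℝ)| * |acf F (h, k)|
  col : ∀ k : ℤ, Summable fun h : ℤ => |(h : ℝ)| * |acf F (h, k)|
  cross : Summable fun t : ℤ × ℤ => |(t.1 : ℝ)| * |(t.2 : ℝ)| * |acf F t|

/-- The class of admissible spectra: positive, with the summability conditions above. -/
structure AdmissibleSpectrum (F : ℝ × ℝ → ℝ) : Prop where
  pos : ∀ w ∈ freqBox, 0 < F w
  summable : SummableSpectrum F

/-- The regularity condition on a family of spectra `F θ`, `θ ∈ Θ`: twice continuously
differentiable in `θ` (with `F`, gradient and Hessian continuous in `(θ, w)`), uniformly bounded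
above and away from zero, every `F θ` admissible, and every component of the gradient and of the
Hessian in the class of summable spectra (derivatives of a spectrum change sign, so positivity is
not asked of them). -/
structure RegularSpectra {p : ℕ} (Θ : Set (EuclideanSpace ℝ (Fin p)))
    (F : EuclideanSpace ℝ (Fin p) → ℝ × ℝ → ℝ) : Prop where
  bounded : ∃ c C : ℝ, 0 < c ∧ ∀ θ ∈ Θ, ∀ w ∈ freqBox, c ≤ F θ w ∧ F θ w ≤ C
  admissible : ∀ θ ∈ Θ, AdmissibleSpectrum (F θ)
  continuousOn : ContinuousOn (fun q : EuclideanSpace ℝ (Fin p) × (ℝ × ℝ) => F q.1 q.2)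
    (Θ ×ˢ freqBox)
  smooth : ∃ (G : EuclideanSpace ℝ (Fin p) → ℝ × ℝ → EuclideanSpace ℝ (Fin p))
      (H : EuclideanSpace ℝ (Fin p) → ℝ × ℝ →
        (EuclideanSpace ℝ (Fin p) →L[ℝ] EuclideanSpace ℝ (Fin p))),
    (∀ θ ∈ Θ, ∀ w ∈ freqBox, HasGradientWithinAt (fun η => F η w) (G θ w) Θ θ) ∧
    (∀ θ ∈ Θ, ∀ w ∈ freqBox, HasFDerivWithinAt (fun η => G η w) (H θ w) Θ θ) ∧
    ContinuousOn (fun q : EuclideanSpace ℝ (Fin p) × (ℝ × ℝ) => G q.1 q.2) (Θ ×ˢ freqBox) ∧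
    ContinuousOn (fun q : EuclideanSpace ℝ (Fin p) × (ℝ × ℝ) => H q.1 q.2) (Θ ×ˢ freqBox) ∧
    (∀ θ ∈ Θ, ∀ i, SummableSpectrum fun w => G θ w i) ∧
    (∀ θ ∈ Θ, ∀ i j, SummableSpectrum fun w => H θ w (EuclideanSpace.single j 1) i)

/-- Distinct parameters give distinct spectra. -/
def Identifiable {p : ℕ} (Θ : Set (EuclideanSpace ℝ (Fin p)))
    (F : EuclideanSpace ℝ (Fin p) → ℝ × ℝ → ℝ) : Prop :=
  ∀ θ₁ ∈ Θ, ∀ θ₂ ∈ Θ, (∀ w ∈ freqBox, F θ₁ w = F θ₂ w) → θ₁ = θ₂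

/-- The lattice site `(r, s)`, `1 ≤ r, s ≤ N`, of an entry of the `N × N` sample. -/
def site {N : ℕ} (i : Fin N × Fin N) : ℤ × ℤ := ((i.1 : ℤ) + 1, (i.2 : ℤ) + 1)

/-- The `N² × N²` block-Toeplitz covariance matrix `Σ(F)` of the `N × N` sample. -/
def covMat (N : ℕ) (F : ℝ × ℝ → ℝ) : Matrix (Fin N × Fin N) (Fin N × Fin N) ℝ :=
  Matrix.of fun i j => acf F (site i - site j)

/-- The regression matrix: its columns are the lattice functions `X ℓ` on the `N × N` sample. -/
def regMat {L : ℕ} (N : ℕ) (X : Fin L → ℤ × ℤ → ℝ) : Matrix (Fin N × Fin N) (Fin L) ℝ :=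
  Matrix.of fun i l => X l (site i)

/-- The `N × N` sample of a lattice function, as a vector of length `N²`. -/
def sample (N : ℕ) (y : ℤ × ℤ → ℝ) (i : Fin N × Fin N) : ℝ := y (site i)

/-- The vector `Y - X β` on the `N × N` sample of `y`. -/
def residual {L : ℕ} (X : Fin L → ℤ × ℤ → ℝ) (N : ℕ) (y : ℤ × ℤ → ℝ)
    (β : EuclideanSpace ℝ (Fin L)) : Fin N × Fin N → ℝ :=
  sample N y - (regMat N X).mulVec (fun l => β l)

/-- The Gaussian log likelihood of the `N × N` sample of `y`, up to an additive constant: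
`-½ log |Σ(F_θ)| - ½ (Y - X β)' Σ⁻¹(F_θ) (Y - X β)`. -/
def logLik {p L : ℕ} (F : EuclideanSpace ℝ (Fin p) → ℝ × ℝ → ℝ) (X : Fin L → ℤ × ℤ → ℝ)
    (N : ℕ) (y : ℤ × ℤ → ℝ) (θ : EuclideanSpace ℝ (Fin p)) (β : EuclideanSpace ℝ (Fin L)) : ℝ :=
  -(1 / 2) * Real.log (covMat N (F θ)).det
    - (1 / 2) * dotProduct (residual X N y β) (((covMat N (F θ))⁻¹).mulVec (residual X N y β))

/-- The posterior expectation of `g (θ, β)` given the `N × N` sample of `y`: the posterior is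
proportional to the likelihood times the prior. -/
def posteriorExp {p L : ℕ} {E : Type*} [NormedAddCommGroup E] [NormedSpace ℝ E]
    (F : EuclideanSpace ℝ (Fin p) → ℝ × ℝ → ℝ) (X : Fin L → ℤ × ℤ → ℝ)
    (prior : Measure (EuclideanSpace ℝ (Fin p) × EuclideanSpace ℝ (Fin L)))
    (N : ℕ) (y : ℤ × ℤ → ℝ)
    (g : EuclideanSpace ℝ (Fin p) × EuclideanSpace ℝ (Fin L) → E) : E :=
  (∫ φ, Real.exp (logLik F X N y φ.1 φ.2) ∂prior)⁻¹ •
    ∫ φ, Real.exp (logLik F X N y φ.1 φ.2) • g φ ∂prior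

end LatticeField

end

/-!
Divided by `N²`, the log likelihood ratio of `(θ, β)` against the truth concentrates at minus a
Gaussian relative entropy. That entropy is at least of the order `N²` off the truth: either some
autocovariance differs, and with it a positive fraction of the entries of the covariance matrices,
or only the mean differs, and then the limit of the normalised information matrix is positive
definite. The log likelihood also varies by at most a small multiple of `N²` over a suitable
neighbourhood of each parameter, with high probability. By compactness, the posterior then gives
exponentially small mass to the complement of every neighbourhood of the truth.
-/

noncomputable section

namespace LatticeField

open Matrix
open scoped MatrixOrder

section LoewnerOrder

variable {ι : Type*}

lemma diag_mono {A B : Matrix ι ι ℝ} (h : A ≤ B) (i : ι) : A i i ≤ B i i := by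
  simpa using (Matrix.le_iff.1 h).diag_nonneg (i := i)

lemma posDef_of_smul_one_le [DecidableEq ι] {A : Matrix ι ι ℝ} {c : ℝ} (hc : 0 < c)
    (h : c • 1 ≤ A) : A.PosDef := by
  simpa using (PosDef.one.smul hc).add_posSemidef (Matrix.le_iff.1 h)

variable [Fintype ι]

lemma dotProduct_mulVec_mono {A B : Matrix ι ι ℝ} (h : A ≤ B) (x : ι → ℝ) :
    x ⬝ᵥ (A *ᵥ x) ≤ x ⬝ᵥ (B *ᵥ x) := by
  have := (Matrix.le_iff.1 h).dotProduct_mulVec_nonneg x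
  rwa [star_trivial, sub_mulVec, dotProduct_sub, sub_nonneg] at this

lemma le_of_dotProduct_mulVec_le {A B : Matrix ι ι ℝ} (hA : A.IsSymm) (hB : B.IsSymm)
    (h : ∀ x, x ⬝ᵥ (A *ᵥ x) ≤ x ⬝ᵥ (B *ᵥ x)) : A ≤ B := by
  refine Matrix.le_iff.2 (.of_dotProduct_mulVec_nonneg ?_ fun x => ?_)
  · rw [IsHermitian, conjTranspose_eq_transpose_of_trivial, transpose_sub, hA, hB]
  · rw [star_trivial, sub_mulVec, dotProduct_sub]
    exact sub_nonneg.2 (h x)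

lemma conj_transpose_mono {κ : Type*} [Finite κ] {A B : Matrix ι ι ℝ} (h : A ≤ B)
    (U : Matrix κ ι ℝ) : U * A * Uᵀ ≤ U * B * Uᵀ := by
  have := (Matrix.le_iff.1 h).mul_mul_conjTranspose_same U
  rwa [conjTranspose_eq_transpose_of_trivial, Matrix.mul_sub, Matrix.sub_mul] at this

lemma dotProduct_smul_one_mulVec [DecidableEq ι] (c : ℝ) (x : ι → ℝ) :
    x ⬝ᵥ ((c • (1 : Matrix ι ι ℝ)) *ᵥ x) = c * (x ⬝ᵥ x) := by
  rw [smul_mulVec, one_mulVec, dotProduct_smul, smul_eq_mul]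

end LoewnerOrder

section Frobenius

variable {ι κ : Type*} [Fintype ι] [Fintype κ]

lemma dotProduct_self_nonneg (v : ι → ℝ) : 0 ≤ v ⬝ᵥ v :=
  Finset.sum_nonneg fun i _ => mul_self_nonneg (v i)

lemma dotProduct_add_self_le (v w : ι → ℝ) :
    (v + w) ⬝ᵥ (v + w) ≤ 2 * (v ⬝ᵥ v) + 2 * (w ⬝ᵥ w) := by
  have := dotProduct_self_nonneg (v - w)
  simp only [add_dotProduct, dotProduct_add, sub_dotProduct, dotProduct_sub] at this ⊢
  linarith

lemma dotProduct_sq_le (v w : ι → ℝ) : (v ⬝ᵥ w) ^ 2 ≤ (v ⬝ᵥ v) * (w ⬝ᵥ w) := by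
  simp only [dotProduct, ← sq]
  exact Finset.sum_mul_sq_le_sq_mul_sq _ _ _

lemma mulVec_dotProduct_self (T : Matrix ι κ ℝ) (v : κ → ℝ) :
    (T *ᵥ v) ⬝ᵥ (T *ᵥ v) = v ⬝ᵥ ((Tᵀ * T) *ᵥ v) := by
  rw [← mulVec_mulVec, dotProduct_mulVec v, vecMul_transpose]

lemma mulVec_dotProduct_self_le_sum_sq (T : Matrix ι κ ℝ) (v : κ → ℝ) :
    (T *ᵥ v) ⬝ᵥ (T *ᵥ v) ≤ (∑ i, ∑ j, T i j ^ 2) * (v ⬝ᵥ v) := by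
  rw [Finset.sum_mul]
  refine Finset.sum_le_sum fun i _ => ?_
  simpa only [mulVec, dotProduct, ← sq] using
    Finset.sum_mul_sq_le_sq_mul_sq Finset.univ (T i) v

lemma mulVec_dotProduct_self_le_of_transpose {T : Matrix ι κ ℝ} {C : ℝ} (hC : 0 ≤ C)
    (hT : ∀ w, (Tᵀ *ᵥ w) ⬝ᵥ (Tᵀ *ᵥ w) ≤ C * (w ⬝ᵥ w)) (v : κ → ℝ) :
    (T *ᵥ v) ⬝ᵥ (T *ᵥ v) ≤ C * (v ⬝ᵥ v) := by
  set q := (T *ᵥ v) ⬝ᵥ (T *ᵥ v) with hq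
  have hqv : q = v ⬝ᵥ (Tᵀ *ᵥ (T *ᵥ v)) := by rw [mulVec_mulVec, hq, mulVec_dotProduct_self]
  have hqq : q * q ≤ (C * (v ⬝ᵥ v)) * q := by
    calc q * q = (v ⬝ᵥ (Tᵀ *ᵥ (T *ᵥ v))) ^ 2 := by rw [← hqv, sq]
      _ ≤ (v ⬝ᵥ v) * ((Tᵀ *ᵥ (T *ᵥ v)) ⬝ᵥ (Tᵀ *ᵥ (T *ᵥ v))) := dotProduct_sq_le _ _
      _ ≤ (v ⬝ᵥ v) * (C * q) :=
        mul_le_mul_of_nonneg_left (hT _) (dotProduct_self_nonneg v)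
      _ = (C * (v ⬝ᵥ v)) * q := by ring
  rcases (dotProduct_self_nonneg (T *ᵥ v)).eq_or_lt with h0 | h0
  · exact h0.symm.trans_le (mul_nonneg hC (dotProduct_self_nonneg v))
  · exact le_of_mul_le_mul_right hqq h0

lemma sum_sq_mul_le {μ : Type*} [Fintype μ] {T : Matrix ι κ ℝ} {C : ℝ}
    (hT : ∀ v, (T *ᵥ v) ⬝ᵥ (T *ᵥ v) ≤ C * (v ⬝ᵥ v)) (K : Matrix κ μ ℝ) :
    ∑ i, ∑ j, (T * K) i j ^ 2 ≤ C * ∑ i, ∑ j, K i j ^ 2 := by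
  rw [Finset.sum_comm, Finset.sum_comm (f := fun i j => K i j ^ 2), Finset.mul_sum]
  refine Finset.sum_le_sum fun j _ => ?_
  simpa only [dotProduct, mulVec, ← sq, mul_apply] using hT fun i => K i j

lemma sum_sq_transpose (K : Matrix ι κ ℝ) : ∑ i, ∑ j, Kᵀ i j ^ 2 = ∑ i, ∑ j, K i j ^ 2 :=
  Finset.sum_comm

lemma sum_sq_mul_mul_transpose_le {T : Matrix ι κ ℝ} {C : ℝ} (hC : 0 ≤ C)
    (hT : ∀ v, (T *ᵥ v) ⬝ᵥ (T *ᵥ v) ≤ C * (v ⬝ᵥ v)) (K : Matrix κ κ ℝ) :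
    ∑ i, ∑ j, (T * K * Tᵀ) i j ^ 2 ≤ C ^ 2 * ∑ i, ∑ j, K i j ^ 2 := by
  calc ∑ i, ∑ j, (T * K * Tᵀ) i j ^ 2 = ∑ i, ∑ j, (T * (T * K)ᵀ) i j ^ 2 := by
        rw [← sum_sq_transpose, transpose_mul, transpose_transpose]
    _ ≤ C * ∑ i, ∑ j, (T * K) i j ^ 2 := by
        rw [← sum_sq_transpose (T * K)]
        exact sum_sq_mul_le hT _
    _ ≤ C * (C * ∑ i, ∑ j, K i j ^ 2) := mul_le_mul_of_nonneg_left (sum_sq_mul_le hT K) hC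
    _ = C ^ 2 * ∑ i, ∑ j, K i j ^ 2 := by ring

end Frobenius

section SimultaneousDiagonalization

variable {ι : Type*} [Fintype ι] [DecidableEq ι] {A B U : Matrix ι ι ℝ} {e : ι → ℝ}

lemma exists_whitening (hA : A.PosDef) : ∃ V : Matrix ι ι ℝ, V * A * Vᵀ = 1 := by
  have hS : CFC.sqrt A * CFC.sqrt A = A := CFC.sqrt_mul_sqrt_self A hA.posSemidef.nonneg
  have hdet : IsUnit (CFC.sqrt A).det := by
    refine isUnit_of_mul_isUnit_left (y := (CFC.sqrt A).det) ?_
    rw [← det_mul, hS]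
    exact (isUnit_iff_isUnit_det A).1 hA.isUnit
  have hsymm : (CFC.sqrt A)ᵀ = CFC.sqrt A := by
    have := (Matrix.nonneg_iff_posSemidef.1 (CFC.sqrt_nonneg A)).1
    rwa [IsHermitian, conjTranspose_eq_transpose_of_trivial] at this
  refine ⟨(CFC.sqrt A)⁻¹, ?_⟩
  rw [transpose_nonsing_inv, hsymm]
  nth_rw 2 [← hS]
  rw [nonsing_inv_mul_cancel_left _ _ hdet, mul_nonsing_inv _ hdet]

lemma exists_orthogonal_diagonal (hA : A.IsHermitian) :
    ∃ O : Matrix ι ι ℝ, O * Oᵀ = 1 ∧ O * A * Oᵀ = diagonal hA.eigenvalues := by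
  have htr : ((star hA.eigenvectorUnitary : unitaryGroup ι ℝ) : Matrix ι ι ℝ)ᵀ
      = hA.eigenvectorUnitary := by
    rw [Unitary.coe_star, star_eq_conjTranspose, conjTranspose_eq_transpose_of_trivial,
      transpose_transpose]
  refine ⟨(star hA.eigenvectorUnitary : unitaryGroup ι ℝ), ?_, ?_⟩ <;> rw [htr]
  · exact Unitary.coe_star_mul_self hA.eigenvectorUnitary
  · simpa [Unitary.conjStarAlgAut_apply] using hA.conjStarAlgAut_star_eigenvectorUnitary

/-- `U` diagonalizes the positive definite forms `A` and `B` by congruence: it takes `A` to the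
identity and `B` to the diagonal matrix of `e`. -/
structure SimDiag (A B U : Matrix ι ι ℝ) (e : ι → ℝ) : Prop where
  left : U * A * Uᵀ = 1
  right : U * B * Uᵀ = diagonal e
  pos : ∀ i, 0 < e i

lemma exists_simDiag (hA : A.PosDef) (hB : B.PosDef) : ∃ U e, SimDiag A B U e := by
  obtain ⟨V, hV⟩ := exists_whitening hA
  have hVunit : IsUnit V := by
    rw [Matrix.mul_assoc] at hV
    exact IsUnit.of_mul_eq_one _ hV
  have hK : (V * B * Vᵀ).PosDef := by
    have := hB.mul_mul_conjTranspose_same (vecMul_injective_of_isUnit hVunit)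
    rwa [conjTranspose_eq_transpose_of_trivial] at this
  obtain ⟨O, hO, hOK⟩ := exists_orthogonal_diagonal hK.1
  refine ⟨O * V, hK.1.eigenvalues, ?_, ?_, hK.eigenvalues_pos⟩
  · calc O * V * A * (O * V)ᵀ = O * (V * A * Vᵀ) * Oᵀ := by
          rw [transpose_mul]; simp only [Matrix.mul_assoc]
      _ = 1 := by rw [hV, Matrix.mul_one, hO]
  · rw [← hOK, transpose_mul]
    simp only [Matrix.mul_assoc]

lemma inv_eq_of_conj_transpose_eq {D D' : Matrix ι ι ℝ} (h : U * A * Uᵀ = D) (hD : D * D' = 1) :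
    A⁻¹ = Uᵀ * D' * U := by
  refine inv_eq_right_inv ?_
  have hU : U * (A * Uᵀ * D') = 1 := by rw [← hD, ← h]; simp only [Matrix.mul_assoc]
  rw [← mul_eq_one_comm.1 hU]
  simp only [Matrix.mul_assoc]

namespace SimDiag

lemma isUnit_det (h : SimDiag A B U e) : IsUnit U.det := by
  have hU : U * (A * Uᵀ) = 1 := by rw [← Matrix.mul_assoc, h.left]
  exact (isUnit_iff_isUnit_det U).1 (IsUnit.of_mul_eq_one _ hU)

lemma inv_left (h : SimDiag A B U e) : A⁻¹ = Uᵀ * U := by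
  rw [inv_eq_of_conj_transpose_eq h.left (Matrix.one_mul 1), Matrix.mul_one]

lemma inv_right (h : SimDiag A B U e) : B⁻¹ = Uᵀ * diagonal (fun i => (e i)⁻¹) * U := by
  refine inv_eq_of_conj_transpose_eq h.right ?_
  rw [diagonal_mul_diagonal, ← diagonal_one]
  exact congrArg diagonal (funext fun i => mul_inv_cancel₀ (h.pos i).ne')

lemma dotProduct_inv_left (h : SimDiag A B U e) (x : ι → ℝ) :
    x ⬝ᵥ (A⁻¹ *ᵥ x) = ∑ i, (U *ᵥ x) i ^ 2 := by
  rw [h.inv_left, ← mulVec_dotProduct_self]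
  simp only [dotProduct, sq]

lemma dotProduct_inv_right (h : SimDiag A B U e) (x : ι → ℝ) :
    x ⬝ᵥ (B⁻¹ *ᵥ x) = ∑ i, (e i)⁻¹ * (U *ᵥ x) i ^ 2 := by
  rw [h.inv_right, ← mulVec_mulVec, ← mulVec_mulVec, dotProduct_mulVec, vecMul_transpose]
  simp only [dotProduct, mulVec_diagonal]
  exact Finset.sum_congr rfl fun i _ => by ring

lemma trace_inv_right_mul_left (h : SimDiag A B U e) : (B⁻¹ * A).trace = ∑ i, (e i)⁻¹ := by
  calc (B⁻¹ * A).trace = (diagonal (fun i => (e i)⁻¹) * (U * A * Uᵀ)).trace := by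
        rw [h.inv_right, Matrix.mul_assoc, Matrix.mul_assoc, trace_mul_comm]
        simp only [Matrix.mul_assoc]
    _ = ∑ i, (e i)⁻¹ := by rw [h.left, Matrix.mul_one, trace_diagonal]

lemma log_det (h : SimDiag A B U e) :
    Real.log B.det = Real.log A.det + ∑ i, Real.log (e i) := by
  have hA : U.det * A.det * U.det = 1 := by simpa using congrArg det h.left
  have hB : U.det * B.det * U.det = ∏ i, e i := by simpa using congrArg det h.right
  have hA0 : A.det ≠ 0 := by rintro h0; simp [h0] at hA
  have hBA : B.det = A.det * ∏ i, e i := by linear_combination A.det * hB - B.det * hA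
  rw [hBA, Real.log_mul hA0 (Finset.prod_ne_zero_iff.2 fun i _ => (h.pos i).ne'),
    Real.log_prod fun i _ => (h.pos i).ne']

lemma eigenvalue_le (h : SimDiag A B U e) {k : ℝ} (hk : B ≤ k • A) (i : ι) : e i ≤ k := by
  simpa [h.left, h.right] using diag_mono (conj_transpose_mono hk U) i

lemma inv_eigenvalue_le (h : SimDiag A B U e) {k : ℝ} (hk : A ≤ k • B) (i : ι) :
    (e i)⁻¹ ≤ k := by
  rw [inv_le_iff_one_le_mul₀ (h.pos i)]
  simpa [h.left, h.right] using diag_mono (conj_transpose_mono hk U) i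

lemma sum_sq_sub_le (h : SimDiag A B U e) {C : ℝ} (hC : 0 ≤ C) (hA : A ≤ C • 1) :
    ∑ i, ∑ j, (A i j - B i j) ^ 2 ≤ C ^ 2 * ∑ i, (e i - 1) ^ 2 := by
  have hUU : U⁻¹ * U = 1 := nonsing_inv_mul _ h.isUnit_det
  have hconj (K : Matrix ι ι ℝ) : U⁻¹ * (U * K * Uᵀ) * U⁻¹ᵀ = K := by
    calc U⁻¹ * (U * K * Uᵀ) * U⁻¹ᵀ = (U⁻¹ * U) * K * (U⁻¹ * U)ᵀ := by
          rw [transpose_mul]; simp only [Matrix.mul_assoc]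
      _ = K := by rw [hUU, transpose_one, Matrix.one_mul, Matrix.mul_one]
  have hA' : U⁻¹ * U⁻¹ᵀ = A := by rw [← hconj A, h.left, Matrix.mul_one]
  have hsub : A - B = U⁻¹ * diagonal (fun i => 1 - e i) * U⁻¹ᵀ := by
    rw [← hconj (A - B), Matrix.mul_sub, Matrix.sub_mul, h.left, h.right, ← diagonal_one,
      diagonal_sub]
  have hT : ∀ w, (U⁻¹ᵀ *ᵥ w) ⬝ᵥ (U⁻¹ᵀ *ᵥ w) ≤ C * (w ⬝ᵥ w) := fun w => by
    rw [mulVec_dotProduct_self, transpose_transpose, hA', ← dotProduct_smul_one_mulVec]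
    exact dotProduct_mulVec_mono hA w
  have hdiag : ∑ i, ∑ j, diagonal (fun i => 1 - e i) i j ^ 2 = ∑ i, (e i - 1) ^ 2 := by
    refine Finset.sum_congr rfl fun i _ => ?_
    simp only [diagonal_apply, ite_pow, zero_pow two_ne_zero, Finset.sum_ite_eq,
      Finset.mem_univ, if_true]
    ring
  simp only [← Matrix.sub_apply, hsub]
  rw [← hdiag]
  exact sum_sq_mul_mul_transpose_le hC (mulVec_dotProduct_self_le_of_transpose hC hT) _

lemma inv_dotProduct_le (h : SimDiag A B U e) {k : ℝ} (hk : A ≤ k • B) (x : ι → ℝ) :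
    x ⬝ᵥ (B⁻¹ *ᵥ x) ≤ k * (x ⬝ᵥ (A⁻¹ *ᵥ x)) := by
  rw [h.dotProduct_inv_left, h.dotProduct_inv_right, Finset.mul_sum]
  exact Finset.sum_le_sum fun i _ =>
    mul_le_mul_of_nonneg_right (h.inv_eigenvalue_le hk i) (sq_nonneg _)

end SimDiag

lemma inv_dotProduct_le (hA : A.PosDef) (hB : B.PosDef) {k : ℝ} (hk : A ≤ k • B) (x : ι → ℝ) :
    x ⬝ᵥ (B⁻¹ *ᵥ x) ≤ k * (x ⬝ᵥ (A⁻¹ *ᵥ x)) := by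
  obtain ⟨U, e, h⟩ := exists_simDiag hA hB
  exact h.inv_dotProduct_le hk x

lemma inv_dotProduct_le_of_smul_one_le {c : ℝ} (hc : 0 < c) (h : c • 1 ≤ A) (x : ι → ℝ) :
    x ⬝ᵥ (A⁻¹ *ᵥ x) ≤ c⁻¹ * (x ⬝ᵥ x) := by
  have hk : (1 : Matrix ι ι ℝ) ≤ c⁻¹ • A := by
    simpa [smul_smul, hc.ne'] using smul_le_smul_of_nonneg_left h (inv_pos.2 hc).le
  simpa using inv_dotProduct_le PosDef.one (posDef_of_smul_one_le hc h) hk x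

lemma dotProduct_self_le_inv (hA : A.PosDef) {C : ℝ} (h : A ≤ C • 1) (x : ι → ℝ) :
    x ⬝ᵥ x ≤ C * (x ⬝ᵥ (A⁻¹ *ᵥ x)) := by
  simpa using inv_dotProduct_le hA PosDef.one h x

end SimultaneousDiagonalization

section GaussianLikelihood

variable {ι : Type*} [Fintype ι] [DecidableEq ι] {A B U : Matrix ι ι ℝ} {e : ι → ℝ}

/-- The log density at `r` of the centred Gaussian law with covariance matrix `A`, up to the
additive constant `-(n / 2) log (2π)`. -/
def gaussianLogLik (A : Matrix ι ι ℝ) (r : ι → ℝ) : ℝ :=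
  -(1 / 2) * Real.log A.det - 1 / 2 * (r ⬝ᵥ (A⁻¹ *ᵥ r))

/-- The Kullback-Leibler divergence `KL(N(0, A) ‖ N(g, B))`, the expected log likelihood ratio
under the centred Gaussian law with covariance matrix `A`. -/
def gaussianKL (A B : Matrix ι ι ℝ) (g : ι → ℝ) : ℝ :=
  1 / 2 * ((B⁻¹ * A).trace - Fintype.card ι + Real.log B.det - Real.log A.det
    + g ⬝ᵥ (B⁻¹ *ᵥ g))

lemma sq_sub_one_le_mul_sub_log {x k : ℝ} (hx : 0 < x) (hxk : x ≤ k) :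
    (x - 1) ^ 2 ≤ 2 * (k + 1) * (x - 1 - Real.log x) := by
  have hlog : Real.log x ≤ 2 * (√x - 1) := by
    have := Real.log_le_sub_one_of_pos (Real.sqrt_pos.2 hx)
    rw [Real.log_sqrt hx.le] at this
    linarith
  have hsq : √x ^ 2 = x := Real.sq_sqrt hx.le
  calc (x - 1) ^ 2 = (√x + 1) ^ 2 * (√x - 1) ^ 2 := by
        nth_rw 1 [← hsq]
        ring
    _ ≤ 2 * (k + 1) * (√x - 1) ^ 2 := by
        gcongr
        nlinarith [sq_nonneg (√x - 1)]
    _ ≤ 2 * (k + 1) * (x - 1 - Real.log x) := by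
        gcongr
        · linarith
        · nlinarith

namespace SimDiag

lemma gaussianKL_eq (h : SimDiag A B U e) (g : ι → ℝ) :
    gaussianKL A B g = 1 / 2 * ∑ i, ((e i)⁻¹ - 1 - Real.log (e i)⁻¹)
      + 1 / 2 * (g ⬝ᵥ (B⁻¹ *ᵥ g)) := by
  rw [gaussianKL, h.trace_inv_right_mul_left, h.log_det]
  simp only [Real.log_inv, Finset.sum_sub_distrib, Finset.sum_neg_distrib, Finset.sum_const,
    Finset.card_univ, nsmul_eq_mul, mul_one]
  ring

lemma gaussianLogLik_sub_eq (h : SimDiag A B U e) (r g : ι → ℝ) :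
    gaussianLogLik B (r + g) - gaussianLogLik A r =
      ∑ i, (1 / 2 * Real.log (e i)⁻¹ - 1 / 2 * ((e i)⁻¹ * ((U *ᵥ r) i + (U *ᵥ g) i) ^ 2)
        + 1 / 2 * (U *ᵥ r) i ^ 2) := by
  rw [gaussianLogLik, gaussianLogLik, h.log_det, h.dotProduct_inv_left, h.dotProduct_inv_right,
    mulVec_add]
  simp only [Real.log_inv, Finset.sum_add_distrib, Finset.sum_sub_distrib, ← Finset.mul_sum,
    Finset.sum_neg_distrib, Pi.add_apply]
  ring

lemma gaussianLogLik_sub_add_gaussianKL (h : SimDiag A B U e) (r g : ι → ℝ) :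
    gaussianLogLik B (r + g) - gaussianLogLik A r + gaussianKL A B g =
      ∑ i, (1 / 2 * (1 - (e i)⁻¹) * (U *ᵥ r) i ^ 2 + -((e i)⁻¹ * (U *ᵥ g) i) * (U *ᵥ r) i)
        - ∑ i, 1 / 2 * (1 - (e i)⁻¹) := by
  rw [h.gaussianLogLik_sub_eq, h.gaussianKL_eq, h.dotProduct_inv_right, Finset.mul_sum,
    Finset.mul_sum, ← Finset.sum_add_distrib, ← Finset.sum_add_distrib, ← Finset.sum_sub_distrib]
  exact Finset.sum_congr rfl fun i _ => by ring

end SimDiag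

lemma half_inv_dotProduct_le_gaussianKL (hA : A.PosDef) (hB : B.PosDef) (g : ι → ℝ) :
    1 / 2 * (g ⬝ᵥ (B⁻¹ *ᵥ g)) ≤ gaussianKL A B g := by
  obtain ⟨U, e, h⟩ := exists_simDiag hA hB
  rw [h.gaussianKL_eq]
  have hnonneg : 0 ≤ ∑ i, ((e i)⁻¹ - 1 - Real.log (e i)⁻¹) := Finset.sum_nonneg fun i _ =>
    sub_nonneg.2 (Real.log_le_sub_one_of_pos (inv_pos.2 (h.pos i)))
  linarith

lemma sum_sq_sub_le_gaussianKL (hA : A.PosDef) (hB : B.PosDef) {C k : ℝ} (hC : 0 ≤ C)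
    (hAC : A ≤ C • 1) (hk : 0 ≤ k) (hAB : A ≤ k • B) (hBA : B ≤ k • A) (g : ι → ℝ) :
    ∑ i, ∑ j, (A i j - B i j) ^ 2 ≤ 4 * (C * k) ^ 2 * (k + 1) * gaussianKL A B g := by
  obtain ⟨U, e, h⟩ := exists_simDiag hA hB
  have heig (i : ι) : (e i - 1) ^ 2 ≤
      k ^ 2 * (2 * (k + 1) * ((e i)⁻¹ - 1 - Real.log (e i)⁻¹)) := by
    have he := h.pos i
    calc (e i - 1) ^ 2 = e i ^ 2 * ((e i)⁻¹ - 1) ^ 2 := by field_simp; ring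
      _ ≤ k ^ 2 * (2 * (k + 1) * ((e i)⁻¹ - 1 - Real.log (e i)⁻¹)) := by
        gcongr
        · exact h.eigenvalue_le hBA i
        · exact sq_sub_one_le_mul_sub_log (inv_pos.2 he) (h.inv_eigenvalue_le hAB i)
  have hg : 0 ≤ g ⬝ᵥ (B⁻¹ *ᵥ g) := by simpa using hB.inv.posSemidef.dotProduct_mulVec_nonneg g
  calc ∑ i, ∑ j, (A i j - B i j) ^ 2 ≤ C ^ 2 * ∑ i, (e i - 1) ^ 2 := h.sum_sq_sub_le hC hAC
    _ ≤ C ^ 2 * ∑ i, k ^ 2 * (2 * (k + 1) * ((e i)⁻¹ - 1 - Real.log (e i)⁻¹)) := by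
        gcongr with i
        exact heig i
    _ = 4 * (C * k) ^ 2 * (k + 1) * (gaussianKL A B g - 1 / 2 * (g ⬝ᵥ (B⁻¹ *ᵥ g))) := by
        rw [h.gaussianKL_eq, ← Finset.mul_sum, ← Finset.mul_sum]
        ring
    _ ≤ 4 * (C * k) ^ 2 * (k + 1) * gaussianKL A B g := by
        gcongr
        linarith

lemma log_sub_mul_sq_add_le {x s : ℝ} (hx : 0 < x) (hs : 0 < s) (hxs : x ≤ 1 + s)
    (hsx : x⁻¹ ≤ 1 + s) (w v : ℝ) :
    Real.log x - x * (w + v) ^ 2 + w ^ 2 ≤ s + 2 * s * w ^ 2 + s⁻¹ * v ^ 2 := by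
  have hlog : Real.log x ≤ s := by linarith [Real.log_le_sub_one_of_pos hx]
  have hx' : (1 + s)⁻¹ ≤ x := inv_le_of_inv_le₀ hx hsx
  have hsplit : (1 - 2 * s) * w ^ 2 - s⁻¹ * v ^ 2 ≤ (1 + s)⁻¹ * (w + v) ^ 2 := by
    rw [← div_eq_inv_mul (a := (w + v) ^ 2), le_div_iff₀ (by linarith), ← sub_nonneg]
    calc (0 : ℝ) ≤ s⁻¹ * (s * w + v) ^ 2 + 2 * (s * w) ^ 2 + 2 * v ^ 2 := by positivity
      _ = (w + v) ^ 2 - ((1 - 2 * s) * w ^ 2 - s⁻¹ * v ^ 2) * (1 + s) := by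
        field_simp
        ring
  nlinarith [mul_le_mul_of_nonneg_right hx' (sq_nonneg (w + v))]

lemma gaussianLogLik_sub_le (hA : A.PosDef) (hB : B.PosDef) {s : ℝ} (hs : 0 < s)
    (hAB : A ≤ (1 + s) • B) (hBA : B ≤ (1 + s) • A) (r g : ι → ℝ) :
    gaussianLogLik B (r + g) - gaussianLogLik A r ≤
      1 / 2 * s * Fintype.card ι + s * (r ⬝ᵥ (A⁻¹ *ᵥ r)) + 1 / 2 * s⁻¹ * (g ⬝ᵥ (A⁻¹ *ᵥ g)) := by
  obtain ⟨U, e, h⟩ := exists_simDiag hA hB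
  calc gaussianLogLik B (r + g) - gaussianLogLik A r
      ≤ ∑ i, (1 / 2 * s + s * (U *ᵥ r) i ^ 2 + 1 / 2 * s⁻¹ * (U *ᵥ g) i ^ 2) := by
        rw [h.gaussianLogLik_sub_eq]
        refine Finset.sum_le_sum fun i _ => ?_
        linarith [log_sub_mul_sq_add_le (inv_pos.2 (h.pos i)) hs (h.inv_eigenvalue_le hAB i)
          (by simpa using h.eigenvalue_le hBA i) ((U *ᵥ r) i) ((U *ᵥ g) i)]
    _ = _ := by
        rw [h.dotProduct_inv_left, h.dotProduct_inv_left, Finset.sum_add_distrib,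
          Finset.sum_add_distrib, Finset.mul_sum, Finset.mul_sum, Finset.sum_const,
          Finset.card_univ, nsmul_eq_mul]
        ring

end GaussianLikelihood

section GaussianQuadratic

lemma memLp_sq_gaussianReal : MemLp (fun x : ℝ => x ^ 2) 2 (gaussianReal 0 1) := by
  have h4 : MemLp (id : ℝ → ℝ) 4 (gaussianReal 0 1) := memLp_id_gaussianReal' 4 (by simp)
  have : ENNReal.HolderTriple 4 4 2 := ⟨by
    rw [show (4 : ENNReal) = 2 * 2 by norm_num, ENNReal.mul_inv (by simp) (by simp), ← mul_add,
      ENNReal.inv_two_add_inv_two, mul_one]⟩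
  simpa [Pi.mul_def, sq] using h4.mul h4

/-- The variance of the square of a standard normal variable. Its value `2` plays no role: the
concentration bounds below only need a finite constant. -/
def chiSqVar : ℝ := Var[fun x => x ^ 2; gaussianReal 0 1]

lemma chiSqVar_nonneg : 0 ≤ chiSqVar := variance_nonneg _ _

lemma integral_sq_gaussianReal : ∫ x, x ^ 2 ∂(gaussianReal 0 1) = 1 := by
  have := variance_of_integral_eq_zero (X := fun x : ℝ => x) (μ := gaussianReal 0 1)
    (by fun_prop) integral_id_gaussianReal
  rw [variance_fun_id_gaussianReal] at this
  simpa using this.symm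

lemma covariance_sq_id_gaussianReal : cov[fun x => x ^ 2, fun x => x; gaussianReal 0 1] = 0 := by
  have hneg : cov[fun x => x ^ 2, fun x => x; gaussianReal 0 1]
      = -cov[fun x => x ^ 2, fun x => x; gaussianReal 0 1] := by
    have hmap : (gaussianReal 0 1).map (fun x => -x) = gaussianReal 0 1 := by
      rw [gaussianReal_map_neg, neg_zero]
    rw [← covariance_fun_neg_right]
    conv_lhs => rw [← hmap]
    rw [covariance_map_fun (by fun_prop) (by fun_prop) (by fun_prop)]
    simp only [neg_sq]
  linarith

lemma memLp_quadratic_gaussianReal (a b : ℝ) :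
    MemLp (fun x : ℝ => a * x ^ 2 + b * x) 2 (gaussianReal 0 1) :=
  (memLp_sq_gaussianReal.const_mul a).add ((memLp_id_gaussianReal' 2 (by simp)).const_mul b)

lemma integral_quadratic_gaussianReal (a b : ℝ) :
    ∫ x, (a * x ^ 2 + b * x) ∂(gaussianReal 0 1) = a := by
  have hid : Integrable (fun x : ℝ => x) (gaussianReal 0 1) :=
    (memLp_id_gaussianReal' 1 (by simp)).integrable le_rfl
  rw [integral_add ((memLp_sq_gaussianReal.integrable (by norm_num)).const_mul a)
      (hid.const_mul b), integral_const_mul, integral_const_mul, integral_sq_gaussianReal,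
    integral_id_gaussianReal, mul_one, mul_zero, add_zero]

lemma variance_quadratic_gaussianReal (a b : ℝ) :
    Var[fun x : ℝ => a * x ^ 2 + b * x; gaussianReal 0 1] = chiSqVar * a ^ 2 + b ^ 2 := by
  have hid : MemLp (fun x : ℝ => x) 2 (gaussianReal 0 1) := memLp_id_gaussianReal' 2 (by simp)
  rw [variance_fun_add (memLp_sq_gaussianReal.const_mul a) (hid.const_mul b),
    variance_const_mul, variance_const_mul, covariance_const_mul_left, covariance_const_mul_right,
    covariance_sq_id_gaussianReal, variance_fun_id_gaussianReal, chiSqVar, NNReal.coe_one]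
  ring

variable {Ω : Type*} [MeasurableSpace Ω] {P : Measure Ω} {ι : Type*} [Fintype ι]

lemma measure_le_abs_quadratic_sub_le [IsProbabilityMeasure P] {W : ι → Ω → ℝ}
    (hind : iIndepFun W P) (hW : ∀ i, HasLaw (W i) (gaussianReal 0 1) P) (a b : ι → ℝ) {s : ℝ}
    (hs : 0 < s) :
    P {ω | s ≤ |∑ i, (a i * W i ω ^ 2 + b i * W i ω) - ∑ i, a i|} ≤
      ENNReal.ofReal ((chiSqVar * ∑ i, a i ^ 2 + ∑ i, b i ^ 2) / s ^ 2) := by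
  let Z (i : ι) (ω : Ω) : ℝ := a i * W i ω ^ 2 + b i * W i ω
  have hg (i : ι) : Measurable fun x : ℝ => a i * x ^ 2 + b i * x := by fun_prop
  have hZmem (i : ι) : MemLp (Z i) 2 P := by
    have := memLp_quadratic_gaussianReal (a i) (b i)
    rwa [← (hW i).map_eq, memLp_map_measure_iff (by fun_prop) (hW i).aemeasurable] at this
  have hZmean (i : ι) : ∫ ω, Z i ω ∂P = a i := by
    rw [← integral_quadratic_gaussianReal (a i) (b i)]
    exact (hW i).integral_comp (hg i).aestronglyMeasurable
  have hZvar (i : ι) : Var[Z i; P] = chiSqVar * a i ^ 2 + b i ^ 2 := by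
    rw [← variance_quadratic_gaussianReal, ← (hW i).map_eq,
      variance_map (hg i).aemeasurable (hW i).aemeasurable]
    rfl
  have hZind : iIndepFun Z P := hind.comp _ hg
  have hmean : ∫ ω, (∑ i, Z i) ω ∂P = ∑ i, a i := by
    simp only [Finset.sum_apply]
    rw [integral_finsetSum _ fun i _ => (hZmem i).integrable (by norm_num)]
    exact Finset.sum_congr rfl fun i _ => hZmean i
  have hvar : Var[∑ i, Z i; P] = chiSqVar * ∑ i, a i ^ 2 + ∑ i, b i ^ 2 := by
    rw [IndepFun.variance_sum (fun i _ => hZmem i) fun i _ j _ hij => hZind.indepFun hij,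
      Finset.mul_sum, ← Finset.sum_add_distrib]
    exact Finset.sum_congr rfl fun i _ => hZvar i
  have hcheb := meas_ge_le_variance_div_sq (memLp_finsetSum' Finset.univ fun i _ => hZmem i) hs
  rw [hmean, hvar] at hcheb
  simpa only [Finset.sum_apply] using hcheb

end GaussianQuadratic

section GaussianVector

variable {Ω : Type*} [MeasurableSpace Ω] {P : Measure Ω} {ι : Type*} {A B : Matrix ι ι ℝ}
  {R : Ω → ι → ℝ}

/-- The random vector `R` has the centred Gaussian law with covariance matrix `A`. -/
structure IsCenteredGaussian (P : Measure Ω) (A : Matrix ι ι ℝ) (R : Ω → ι → ℝ) : Prop where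
  hasGaussianLaw : HasGaussianLaw R P
  integral_eq_zero : ∀ i, ∫ ω, R ω i ∂P = 0
  covariance_eq : ∀ i j, cov[fun ω => R ω i, fun ω => R ω j; P] = A i j

namespace IsCenteredGaussian

lemma hasGaussianLaw_apply (h : IsCenteredGaussian P A R) (i : ι) :
    HasGaussianLaw (fun ω => R ω i) P :=
  HasGaussianLaw.eval (X := fun i ω => R ω i) h.hasGaussianLaw i

lemma mulVec [Fintype ι] {κ : Type*} [Finite κ] (h : IsCenteredGaussian P A R) (U : Matrix κ ι ℝ) :
    IsCenteredGaussian P (U * A * Uᵀ) fun ω => U *ᵥ R ω := by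
  have := Fintype.ofFinite κ
  have hR (i : ι) : MemLp (fun ω => R ω i) 2 P := (h.hasGaussianLaw_apply i).memLp_two
  have : IsProbabilityMeasure P := h.hasGaussianLaw.isProbabilityMeasure
  refine ⟨h.hasGaussianLaw.map (LinearMap.toContinuousLinearMap U.mulVecLin), fun i => ?_,
    fun i j => ?_⟩
  · simp only [Matrix.mulVec, dotProduct]
    rw [integral_finsetSum _ fun k _ => ((hR k).integrable (by norm_num)).const_mul _]
    simp only [integral_const_mul, h.integral_eq_zero, mul_zero, Finset.sum_const_zero]
  · simp only [Matrix.mulVec, dotProduct]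
    rw [covariance_fun_sum_fun_sum (fun k => (hR k).const_mul _) fun k => (hR k).const_mul _]
    simp only [covariance_const_mul_left, covariance_const_mul_right, h.covariance_eq, mul_apply,
      transpose_apply, Finset.sum_mul]
    rw [Finset.sum_comm]
    exact Finset.sum_congr rfl fun k _ => Finset.sum_congr rfl fun l _ => by ring

variable [DecidableEq ι]

lemma iIndepFun [Finite ι] (h : IsCenteredGaussian P 1 R) :
    ProbabilityTheory.iIndepFun (fun i ω => R ω i) P :=
  HasGaussianLaw.iIndepFun_of_covariance_eq_zero h.hasGaussianLaw fun i j hij => by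
    rw [h.covariance_eq, one_apply_ne hij]

lemma hasLaw_apply (h : IsCenteredGaussian P 1 R) (i : ι) :
    HasLaw (fun ω => R ω i) (gaussianReal 0 1) P := by
  have hi := h.hasGaussianLaw_apply i
  refine ⟨hi.aemeasurable, ?_⟩
  rw [hi.map_eq_gaussianReal, h.integral_eq_zero, ← covariance_self hi.aemeasurable,
    h.covariance_eq, one_apply_eq, Real.toNNReal_one]

variable [Fintype ι] [IsProbabilityMeasure P]

lemma measure_le_abs_gaussianLogLik_sub_le (h : IsCenteredGaussian P A R) (hA : A.PosDef)
    (hB : B.PosDef) {k : ℝ} (hAB : A ≤ k • B) (g : ι → ℝ) {s : ℝ} (hs : 0 < s) :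
    P {ω | s ≤ |gaussianLogLik B (R ω + g) - gaussianLogLik A (R ω) + gaussianKL A B g|} ≤
      ENNReal.ofReal
        ((chiSqVar * ((1 + k) ^ 2 * Fintype.card ι) + k * (g ⬝ᵥ (B⁻¹ *ᵥ g))) / s ^ 2) := by
  obtain ⟨U, e, hU⟩ := exists_simDiag hA hB
  have hW : IsCenteredGaussian P 1 fun ω => U *ᵥ R ω := hU.left ▸ h.mulVec U
  simp only [hU.gaussianLogLik_sub_add_gaussianKL]
  refine (measure_le_abs_quadratic_sub_le hW.iIndepFun hW.hasLaw_apply _ _ hs).trans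
    (ENNReal.ofReal_le_ofReal ?_)
  have hpos (i : ι) : 0 < (e i)⁻¹ := inv_pos.2 (hU.pos i)
  have hle (i : ι) : (e i)⁻¹ ≤ k := hU.inv_eigenvalue_le hAB i
  gcongr
  · exact chiSqVar_nonneg
  · calc ∑ i, (1 / 2 * (1 - (e i)⁻¹)) ^ 2 ≤ ∑ _i : ι, (1 + k) ^ 2 := by
          refine Finset.sum_le_sum fun i _ => sq_le_sq' ?_ ?_ <;> linarith [hpos i, hle i]
      _ = (1 + k) ^ 2 * Fintype.card ι := by
          rw [Finset.sum_const, Finset.card_univ, nsmul_eq_mul, mul_comm]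
  · rw [hU.dotProduct_inv_right, Finset.mul_sum]
    refine Finset.sum_le_sum fun i _ => ?_
    calc (-((e i)⁻¹ * (U *ᵥ g) i)) ^ 2 = (e i)⁻¹ * ((e i)⁻¹ * (U *ᵥ g) i ^ 2) := by ring
      _ ≤ k * ((e i)⁻¹ * (U *ᵥ g) i ^ 2) :=
        mul_le_mul_of_nonneg_right (hle i) (mul_nonneg (hpos i).le (sq_nonneg _))

lemma measure_le_dotProduct_self_le (h : IsCenteredGaussian P A R) (hA : A.PosDef) {C : ℝ}
    (hC : 0 < C) (hAC : A ≤ C • 1) {s : ℝ} (hs : 0 < s) :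
    P {ω | C * (Fintype.card ι + s) ≤ R ω ⬝ᵥ R ω} ≤
      ENNReal.ofReal (chiSqVar * Fintype.card ι / s ^ 2) := by
  obtain ⟨V, hV⟩ := exists_whitening hA
  have hW : IsCenteredGaussian P 1 fun ω => V *ᵥ R ω := hV ▸ h.mulVec V
  have hnorm (r : ι → ℝ) : r ⬝ᵥ r ≤ C * ∑ i, (V *ᵥ r) i ^ 2 := by
    refine (dotProduct_self_le_inv hA hAC r).trans_eq ?_
    rw [inv_eq_of_conj_transpose_eq hV (Matrix.one_mul 1), Matrix.mul_one,
      ← mulVec_dotProduct_self]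
    simp only [dotProduct, sq]
  have hcheb := measure_le_abs_quadratic_sub_le hW.iIndepFun hW.hasLaw_apply 1 0 hs
  simp only [Pi.one_apply, Pi.zero_apply, one_mul, zero_mul, add_zero, one_pow, Finset.sum_const,
    Finset.card_univ, nsmul_eq_mul, mul_one, zero_pow two_ne_zero, mul_zero] at hcheb
  refine (measure_mono fun ω hω => ?_).trans hcheb
  have := le_of_mul_le_mul_left (hω.trans (hnorm (R ω))) hC
  exact (le_sub_iff_add_le'.2 this).trans (le_abs_self _)

end IsCenteredGaussian

end GaussianVector

section HighProbability

variable {Ω : Type*} [MeasurableSpace Ω] {P : Measure Ω} {κ : Type*} {l : Filter κ}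
  {G H : κ → Ω → Prop}

/-- The events `G n` have probability tending to one along `l`. The events need not be measurable:
the outer measure of the complement tends to zero. -/
def WithHighProb (P : Measure Ω) (l : Filter κ) (G : κ → Ω → Prop) : Prop :=
  Tendsto (fun n => P {ω | ¬ G n ω}) l (𝓝 0)

namespace WithHighProb

lemma mono (hG : WithHighProb P l G) (h : ∀ᶠ n in l, ∀ ω, G n ω → H n ω) :
    WithHighProb P l H := by
  refine tendsto_of_tendsto_of_tendsto_of_le_of_le' tendsto_const_nhds hG
    (Eventually.of_forall fun _ => zero_le) ?_
  filter_upwards [h] with n hn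
  exact measure_mono fun ω hω hGω => hω (hn ω hGω)

lemma and (hG : WithHighProb P l G) (hH : WithHighProb P l H) :
    WithHighProb P l fun n ω => G n ω ∧ H n ω := by
  have hsum := hG.add hH
  rw [add_zero] at hsum
  refine tendsto_of_tendsto_of_tendsto_of_le_of_le tendsto_const_nhds hsum
    (fun _ => zero_le) fun n => (measure_mono fun ω hω => ?_).trans (measure_union_le _ _)
  exact not_and_or.1 hω

lemma of_measure_le {b : κ → ℝ} (hb : Tendsto b l (𝓝 0))
    (h : ∀ᶠ n in l, P {ω | ¬ G n ω} ≤ ENNReal.ofReal (b n)) : WithHighProb P l G := by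
  have hb' := ENNReal.tendsto_ofReal hb
  rw [ENNReal.ofReal_zero] at hb'
  exact tendsto_of_tendsto_of_tendsto_of_le_of_le' tendsto_const_nhds hb'
    (Eventually.of_forall fun _ => zero_le) h

end WithHighProb

end HighProbability

section Tilted

variable {E E' : Type*} [MeasurableSpace E] {μ ν : Measure E} [NormedAddCommGroup E']

lemma tilted_real_le [IsFiniteMeasure μ] {f : E → ℝ} (hf : Integrable (fun x => Real.exp (f x)) μ)
    {A V : Set E} (hA : MeasurableSet A) (hV : 0 < μ V) {s t : ℝ} (hfA : ∀ x ∈ A, f x ≤ s)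
    (hfV : ∀ x ∈ V, t ≤ f x) :
    (μ.tilted f).real A ≤ Real.exp (s - t) * (μ.real A / μ.real V) := by
  have hVpos : 0 < μ.real V := ENNReal.toReal_pos hV.ne' (measure_ne_top _ _)
  have hnum : ∫ x in A, Real.exp (f x) ∂μ ≤ Real.exp s * μ.real A :=
    calc ∫ x in A, Real.exp (f x) ∂μ ≤ ∫ _x in A, Real.exp s ∂μ :=
          setIntegral_mono_on hf.integrableOn (integrable_const _) hA
            fun x hx => Real.exp_le_exp.2 (hfA x hx)
      _ = Real.exp s * μ.real A := by rw [setIntegral_const, smul_eq_mul, mul_comm]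
  have hden : Real.exp t * μ.real V ≤ ∫ x, Real.exp (f x) ∂μ :=
    calc Real.exp t * μ.real V ≤ Real.exp t * μ.real {x | Real.exp t ≤ Real.exp (f x)} := by
          gcongr
          · finiteness
          · exact fun x hx => Real.exp_le_exp.2 (hfV x hx)
      _ ≤ ∫ x, Real.exp (f x) ∂μ :=
          mul_meas_ge_le_integral_of_nonneg (ae_of_all _ fun x => (Real.exp_pos _).le) hf _
  rw [measureReal_def, tilted_apply_eq_ofReal_integral' f hA, integral_div,
    ENNReal.toReal_ofReal (div_nonneg (integral_nonneg fun x => (Real.exp_pos _).le)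
      (integral_nonneg fun x => (Real.exp_pos _).le)), Real.exp_sub, div_mul_div_comm]
  exact div_le_div₀ (by positivity) hnum (by positivity) hden

lemma norm_integral_sub_le [NormedSpace ℝ E'] [CompleteSpace E'] [IsProbabilityMeasure ν]
    {g : E → E'} (hg : Integrable g ν) {A : Set E} (hA : MeasurableSet A) {c : E'} {r D : ℝ}
    (hr : ∀ᵐ x ∂ν, x ∉ A → ‖g x - c‖ ≤ r) (hD : ∀ᵐ x ∂ν, ‖g x - c‖ ≤ D) (hr0 : 0 ≤ r) :
    ‖∫ x, g x ∂ν - c‖ ≤ r + D * ν.real A := by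
  have hsub : ∫ x, g x ∂ν - c = ∫ x, (g x - c) ∂ν := by
    rw [integral_sub hg (integrable_const c), integral_const, probReal_univ, one_smul]
  have hDA : Integrable (A.indicator fun _ => D) ν := (integrable_const D).indicator hA
  have hbound : ∀ᵐ x ∂ν, ‖g x - c‖ ≤ r + A.indicator (fun _ => D) x := by
    filter_upwards [hr, hD] with x hrx hDx
    by_cases hx : x ∈ A
    · rw [Set.indicator_of_mem hx]
      exact hDx.trans (le_add_of_nonneg_left hr0)
    · rw [Set.indicator_of_notMem hx, add_zero]
      exact hrx hx
  calc ‖∫ x, g x ∂ν - c‖ ≤ ∫ x, (r + A.indicator (fun _ => D) x) ∂ν :=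
        hsub ▸ norm_integral_le_of_norm_le ((integrable_const r).add hDA) hbound
    _ = r + D * ν.real A := by
        rw [integral_add (integrable_const r) hDA, integral_const, probReal_univ, one_smul,
          integral_indicator_const _ hA, smul_eq_mul, mul_comm]

lemma integrable_of_continuousOn_isCompact [TopologicalSpace E] [T2Space E]
    [OpensMeasurableSpace E] [IsFiniteMeasure μ] {S : Set E} {g : E → E'} (hS : IsCompact S)
    (hμS : ∀ᵐ φ ∂μ, φ ∈ S) (hg : ContinuousOn g S) : Integrable g μ := by
  rw [← Measure.restrict_eq_self_of_ae_mem hμS]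
  exact hg.integrableOn_compact hS

end Tilted

section Concentration

variable {Ω : Type*} [MeasurableSpace Ω] {P : Measure Ω} {κ : Type*} {l : Filter κ}
  {E : Type*} [TopologicalSpace E] {S : Set E} {φ₀ : E} {ℓ : κ → Ω → E → ℝ} {a : κ → ℝ}

/-- The random functions `ℓ n` on `S` peak at `φ₀` at the rate `a n`: with high probability every
other point loses a multiple of `a n` against `φ₀`, and `ℓ n` varies by an arbitrarily small
multiple of `a n` on suitable neighbourhoods. -/
structure PeaksAt (P : Measure Ω) (l : Filter κ) (a : κ → ℝ) (S : Set E) (φ₀ : E)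
    (ℓ : κ → Ω → E → ℝ) : Prop where
  continuousOn : ∀ n ω, ContinuousOn (ℓ n ω) S
  exists_le_sub : ∀ φ ∈ S, φ ≠ φ₀ →
    ∃ δ > 0, WithHighProb P l fun n ω => ℓ n ω φ ≤ ℓ n ω φ₀ - δ * a n
  exists_abs_sub_le : ∀ φ ∈ S, ∀ η > 0, ∃ V ∈ 𝓝[S] φ,
    WithHighProb P l fun n ω => ∀ ψ ∈ V, |ℓ n ω ψ - ℓ n ω φ| ≤ η * a n

namespace PeaksAt

lemma exists_forall_le_sub (h : PeaksAt P l a S φ₀ ℓ) (ha : Tendsto a l atTop) {K : Set E}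
    (hK : IsCompact K) (hKS : K ⊆ S) (hφ₀ : φ₀ ∉ K) :
    ∃ δ > 0, WithHighProb P l fun n ω => ∀ φ ∈ K, ℓ n ω φ ≤ ℓ n ω φ₀ - δ * a n := by
  refine hK.induction_on ⟨1, one_pos, by simpa [WithHighProb] using tendsto_const_nhds⟩ ?_ ?_ ?_
  · rintro s t hst ⟨δ, hδ, ht⟩
    exact ⟨δ, hδ, ht.mono (Eventually.of_forall fun n ω hω φ hφ => hω φ (hst hφ))⟩
  · rintro s t ⟨δ, hδ, hs⟩ ⟨δ', hδ', ht⟩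
    refine ⟨min δ δ', lt_min hδ hδ', (hs.and ht).mono ?_⟩
    filter_upwards [ha.eventually_ge_atTop 0] with n hn ω hω φ hφ
    have hmin := mul_le_mul_of_nonneg_right (min_le_left δ δ') hn
    have hmin' := mul_le_mul_of_nonneg_right (min_le_right δ δ') hn
    rcases hφ with hφ | hφ
    · linarith [hω.1 φ hφ]
    · linarith [hω.2 φ hφ]
  · intro φ hφ
    obtain ⟨δ, hδ, hφδ⟩ := h.exists_le_sub φ (hKS hφ) fun heq => hφ₀ (heq ▸ hφ)
    obtain ⟨V, hV, hVδ⟩ := h.exists_abs_sub_le φ (hKS hφ) (δ / 2) (half_pos hδ)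
    refine ⟨V, nhdsWithin_mono φ hKS hV, δ / 2, half_pos hδ, (hφδ.and hVδ).mono ?_⟩
    refine Eventually.of_forall fun n ω hω ψ hψ => ?_
    linarith [hω.1, (abs_le.1 (hω.2 ψ hψ)).2]

variable [T2Space E] [MeasurableSpace E] [OpensMeasurableSpace E] {μ : Measure E}
  [IsFiniteMeasure μ]

lemma withHighProb_tilted_diff_lt (h : PeaksAt P l a S φ₀ ℓ) (ha : Tendsto a l atTop)
    (hS : IsCompact S) (hφ₀ : φ₀ ∈ S) (hμS : ∀ᵐ φ ∂μ, φ ∈ S) (hμ₀ : ∀ U ∈ 𝓝 φ₀, 0 < μ U)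
    {U : Set E} (hU : IsOpen U) (hφ₀U : φ₀ ∈ U) {ε : ℝ} (hε : 0 < ε) :
    WithHighProb P l fun n ω => (μ.tilted (ℓ n ω)).real (S \ U) < ε := by
  obtain ⟨δ, hδ, hfar⟩ := h.exists_forall_le_sub ha (hS.diff hU) Set.sdiff_subset
    fun hφ₀' => hφ₀'.2 hφ₀U
  obtain ⟨V, hV, hnear⟩ := h.exists_abs_sub_le φ₀ hφ₀ (δ / 2) (half_pos hδ)
  have hμV : 0 < μ V := by
    refine (hμ₀ _ (mem_nhdsWithin_iff_eventually.1 hV)).trans_le (measure_mono_ae ?_)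
    filter_upwards [hμS] with φ hφ hφV using hφV hφ
  have hlim : Tendsto (fun n => Real.exp (-(δ / 2 * a n)) * (μ.real (S \ U) / μ.real V)) l
      (𝓝 0) := by
    simpa using (Real.tendsto_exp_neg_atTop_nhds_zero.comp
      (ha.const_mul_atTop (half_pos hδ))).mul_const (μ.real (S \ U) / μ.real V)
  refine (hfar.and hnear).mono ?_
  filter_upwards [hlim.eventually_lt_const hε] with n hn ω hω
  refine lt_of_le_of_lt ?_ hn
  have hbound := tilted_real_le
    (integrable_of_continuousOn_isCompact hS hμS (h.continuousOn n ω).rexp)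
    (hS.measurableSet.diff hU.measurableSet) hμV hω.1
    (t := ℓ n ω φ₀ - δ / 2 * a n) fun ψ hψ => by linarith [(abs_le.1 (hω.2 ψ hψ)).1]
  exact hbound.trans_eq (by ring_nf)

theorem tendstoInMeasure_integral_tilted {E' : Type*} [NormedAddCommGroup E'] [NormedSpace ℝ E']
    [CompleteSpace E'] (h : PeaksAt P l a S φ₀ ℓ) (ha : Tendsto a l atTop) (hS : IsCompact S)
    (hφ₀ : φ₀ ∈ S) (hμS : ∀ᵐ φ ∂μ, φ ∈ S) (hμ₀ : ∀ U ∈ 𝓝 φ₀, 0 < μ U)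
    {g : E → E'} (hg : ContinuousOn g S) :
    TendstoInMeasure P (fun n ω => ∫ φ, g φ ∂(μ.tilted (ℓ n ω))) l fun _ => g φ₀ := by
  rw [tendstoInMeasure_iff_norm]
  intro ε hε
  obtain ⟨D, hD⟩ := hS.exists_bound_of_continuousOn (hg.sub continuousOn_const : ContinuousOn
    (fun φ => g φ - g φ₀) S)
  have hD0 : 0 ≤ D := (norm_nonneg _).trans (hD φ₀ hφ₀)
  obtain ⟨U, hU, hφ₀U, hnear⟩ : ∃ U, IsOpen U ∧ φ₀ ∈ U ∧ U ∩ S ⊆ {φ | ‖g φ - g φ₀‖ < ε / 2} := by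
    refine mem_nhdsWithin.1 (((hg φ₀ hφ₀).sub_const (g φ₀)).norm.eventually_lt_const ?_)
    simpa using hε
  have hconc := h.withHighProb_tilted_diff_lt ha hS hφ₀ hμS hμ₀ hU hφ₀U
    (div_pos (half_pos hε) (add_pos_of_nonneg_of_pos hD0 one_pos))
  suffices WithHighProb P l fun n ω => ‖∫ φ, g φ ∂(μ.tilted (ℓ n ω)) - g φ₀‖ < ε by
    simpa only [WithHighProb, not_lt] using this
  refine hconc.mono (Eventually.of_forall fun n ω hω => ?_)
  have hexp := integrable_of_continuousOn_isCompact hS hμS (h.continuousOn n ω).rexp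
  have : NeZero μ := ⟨fun hμ => by simpa [hμ] using hμ₀ Set.univ univ_mem⟩
  have : IsProbabilityMeasure (μ.tilted (ℓ n ω)) := isProbabilityMeasure_tilted hexp
  have hmem : ∀ᵐ φ ∂(μ.tilted (ℓ n ω)), φ ∈ S := (tilted_absolutelyContinuous μ _).ae_le hμS
  have hmean := norm_integral_sub_le (integrable_of_continuousOn_isCompact hS hmem hg)
    (hS.measurableSet.diff hU.measurableSet) (c := g φ₀) (r := ε / 2) (D := D)
    (hmem.mono fun φ hφ hφA => (hnear ⟨by_contra fun hφU => hφA ⟨hφ, hφU⟩, hφ⟩).le)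
    (hmem.mono fun φ hφ => hD φ hφ) (half_pos hε).le
  rw [lt_div_iff₀ (by positivity)] at hω
  nlinarith [measureReal_nonneg (μ := μ.tilted (ℓ n ω)) (s := S \ U)]

end PeaksAt

end Concentration

section Covariance

variable {F G : ℝ × ℝ → ℝ} {N : ℕ}

/-- The phase `h λ₁ + k λ₂` of the character with the lag `t = (h, k)`. -/
def phase (t : ℤ × ℤ) (w : ℝ × ℝ) : ℝ := t.1 * w.1 + t.2 * w.2

@[fun_prop]
lemma continuous_phase (t : ℤ × ℤ) : Continuous (phase t) := by
  unfold phase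
  fun_prop

lemma phase_neg (t : ℤ × ℤ) (w : ℝ × ℝ) : phase (-t) w = -phase t w := by
  simp only [phase, Prod.fst_neg, Prod.snd_neg, Int.cast_neg]
  ring

lemma phase_sub (s t : ℤ × ℤ) (w : ℝ × ℝ) : phase (s - t) w = phase s w - phase t w := by
  simp only [phase, Prod.fst_sub, Prod.snd_sub, Int.cast_sub]
  ring

lemma zmon_neg_eq (t : ℤ × ℤ) : zmon (-t) = fun w => Complex.exp (phase t w * Complex.I) := by
  ext w
  simp only [zmon, phase, Prod.fst_neg, Prod.snd_neg]
  push_cast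
  ring_nf

lemma isCompact_freqBox : IsCompact freqBox := isCompact_Icc.prod isCompact_Icc

lemma measurableSet_freqBox : MeasurableSet freqBox := isCompact_freqBox.measurableSet

lemma acf_eq_integral_cos (hF : IntegrableOn F freqBox) (t : ℤ × ℤ) :
    acf F t = (4 * Real.pi ^ 2)⁻¹ * ∫ w in freqBox, F w * Real.cos (phase t w) := by
  have hint : IntegrableOn (fun w => (F w : ℂ) * zmon (-t) w) freqBox := by
    rw [zmon_neg_eq]
    exact IntegrableOn.mul_continuousOn (Integrable.ofReal hF) (by fun_prop) isCompact_freqBox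
  have hre : ∀ w, ((F w : ℂ) * zmon (-t) w).re = F w * Real.cos (phase t w) := fun w => by
    rw [zmon_neg_eq, Complex.re_ofReal_mul, Complex.exp_ofReal_mul_I_re]
  have hscale : (4 * (Real.pi : ℂ) ^ 2)⁻¹ = (((4 * Real.pi ^ 2)⁻¹ : ℝ) : ℂ) := by push_cast; rfl
  rw [acf, hscale, Complex.re_ofReal_mul, ← RCLike.re_to_complex, ← integral_re hint]
  simp only [RCLike.re_to_complex, hre]

lemma acf_neg (hF : IntegrableOn F freqBox) (t : ℤ × ℤ) : acf F (-t) = acf F t := by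
  simp only [acf_eq_integral_cos hF, phase_neg, Real.cos_neg]

lemma acf_const_mul (c : ℝ) (F : ℝ × ℝ → ℝ) (t : ℤ × ℤ) :
    acf (fun w => c * F w) t = c * acf F t := by
  simp only [acf, Complex.ofReal_mul, mul_assoc, integral_const_mul]
  rw [mul_left_comm, Complex.re_ofReal_mul]

lemma isSymm_covMat (hF : IntegrableOn F freqBox) : (covMat N F).IsSymm :=
  IsSymm.ext fun i j => by
    simp only [covMat, of_apply]
    rw [← acf_neg hF, neg_sub]

lemma covMat_const_mul (c : ℝ) (F : ℝ × ℝ → ℝ) :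
    covMat N (fun w => c * F w) = c • covMat N F := by
  ext i j
  simp only [covMat, of_apply, Matrix.smul_apply, acf_const_mul, smul_eq_mul]

/-- The modulus squared of the trigonometric polynomial `∑ v_t exp (i ⟨t, w⟩)` over the sample. -/
def trigPolyNormSq (v : Fin N × Fin N → ℝ) (w : ℝ × ℝ) : ℝ :=
  (∑ i, v i * Real.cos (phase (site i) w)) ^ 2 + (∑ i, v i * Real.sin (phase (site i) w)) ^ 2

lemma continuous_trigPolyNormSq (v : Fin N × Fin N → ℝ) : Continuous (trigPolyNormSq v) := by
  unfold trigPolyNormSq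
  fun_prop

lemma trigPolyNormSq_nonneg (v : Fin N × Fin N → ℝ) (w : ℝ × ℝ) : 0 ≤ trigPolyNormSq v w :=
  add_nonneg (sq_nonneg _) (sq_nonneg _)

lemma trigPolyNormSq_eq_sum (v : Fin N × Fin N → ℝ) (w : ℝ × ℝ) :
    trigPolyNormSq v w = ∑ i, ∑ j, v i * v j * Real.cos (phase (site i - site j) w) := by
  simp only [trigPolyNormSq, phase_sub, Real.cos_sub, sq, Finset.sum_mul_sum,
    ← Finset.sum_add_distrib]
  exact Finset.sum_congr rfl fun i _ => Finset.sum_congr rfl fun j _ => by ring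

lemma dotProduct_covMat_mulVec (hF : IntegrableOn F freqBox) (v : Fin N × Fin N → ℝ) :
    v ⬝ᵥ (covMat N F *ᵥ v) = (4 * Real.pi ^ 2)⁻¹ * ∫ w in freqBox, F w * trigPolyNormSq v w := by
  have hterm : ∀ i j, IntegrableOn
      (fun w => v i * v j * (F w * Real.cos (phase (site i - site j) w))) freqBox := fun i j =>
    (hF.mul_continuousOn (by fun_prop) isCompact_freqBox).const_mul _
  calc v ⬝ᵥ (covMat N F *ᵥ v)
      = ∑ i, ∑ j, (4 * Real.pi ^ 2)⁻¹ *
          ∫ w in freqBox, v i * v j * (F w * Real.cos (phase (site i - site j) w)) := by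
        simp only [dotProduct, mulVec, covMat, of_apply, Finset.mul_sum, integral_const_mul,
          acf_eq_integral_cos hF]
        exact Finset.sum_congr rfl fun i _ => Finset.sum_congr rfl fun j _ => by ring
    _ = (4 * Real.pi ^ 2)⁻¹ * ∫ w in freqBox, ∑ i, ∑ j,
          v i * v j * (F w * Real.cos (phase (site i - site j) w)) := by
        rw [integral_finsetSum _ fun i _ => integrable_finsetSum _ fun j _ => hterm i j,
          Finset.mul_sum]
        refine Finset.sum_congr rfl fun i _ => ?_
        rw [integral_finsetSum _ fun j _ => hterm i j, Finset.mul_sum]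
    _ = (4 * Real.pi ^ 2)⁻¹ * ∫ w in freqBox, F w * trigPolyNormSq v w := by
        simp only [trigPolyNormSq_eq_sum, Finset.mul_sum, mul_left_comm (F _)]

lemma covMat_mono (hF : IntegrableOn F freqBox) (hG : IntegrableOn G freqBox)
    (h : ∀ w ∈ freqBox, F w ≤ G w) : covMat N F ≤ covMat N G := by
  refine le_of_dotProduct_mulVec_le (isSymm_covMat hF) (isSymm_covMat hG) fun v => ?_
  have hv := (continuous_trigPolyNormSq v).continuousOn (s := freqBox)
  rw [dotProduct_covMat_mulVec hF, dotProduct_covMat_mulVec hG]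
  refine mul_le_mul_of_nonneg_left ?_ (by positivity)
  exact setIntegral_mono_on (hF.mul_continuousOn hv isCompact_freqBox)
    (hG.mul_continuousOn hv isCompact_freqBox) measurableSet_freqBox
    fun w hw => mul_le_mul_of_nonneg_right (h w hw) (trigPolyNormSq_nonneg v w)

lemma covMat_le_smul (hF : IntegrableOn F freqBox) (hG : IntegrableOn G freqBox) {k : ℝ}
    (h : ∀ w ∈ freqBox, F w ≤ k * G w) : covMat N F ≤ k • covMat N G :=
  covMat_const_mul (N := N) k G ▸ covMat_mono hF (hG.const_mul k) h

lemma integral_cos_int_mul {h : ℤ} (hh : h ≠ 0) :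
    ∫ x in Set.Icc (-Real.pi) Real.pi, Real.cos (h * x) = 0 := by
  have hh' : (h : ℝ) ≠ 0 := Int.cast_ne_zero.2 hh
  rw [integral_Icc_eq_integral_Ioc, ← intervalIntegral.integral_of_le (by linarith [Real.pi_pos]),
    intervalIntegral.integral_comp_mul_left (fun x => Real.cos x) hh', integral_cos]
  simp [Real.sin_int_mul_pi]

lemma integral_sin_int_mul (h : ℤ) :
    ∫ x in Set.Icc (-Real.pi) Real.pi, Real.sin (h * x) = 0 := by
  rcases eq_or_ne h 0 with rfl | hh
  · simp
  have hh' : (h : ℝ) ≠ 0 := Int.cast_ne_zero.2 hh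
  rw [integral_Icc_eq_integral_Ioc, ← intervalIntegral.integral_of_le (by linarith [Real.pi_pos]),
    intervalIntegral.integral_comp_mul_left (fun x => Real.sin x) hh', integral_sin]
  simp

lemma integral_cos_phase (t : ℤ × ℤ) :
    ∫ w in freqBox, Real.cos (phase t w) =
      (∫ x in Set.Icc (-Real.pi) Real.pi, Real.cos (t.1 * x)) *
        ∫ y in Set.Icc (-Real.pi) Real.pi, Real.cos (t.2 * y) := by
  simp only [phase, Real.cos_add]
  rw [integral_sub, freqBox, Measure.volume_eq_prod,
    setIntegral_prod_mul (fun x => Real.cos (t.1 * x)) (fun y => Real.cos (t.2 * y)),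
    setIntegral_prod_mul (fun x => Real.sin (t.1 * x)) (fun y => Real.sin (t.2 * y)),
    integral_sin_int_mul, zero_mul, sub_zero] <;>
  exact ContinuousOn.integrableOn_compact isCompact_freqBox (by fun_prop)

lemma integrableOn_const_freqBox (c : ℝ) : IntegrableOn (fun _ => c) freqBox :=
  continuousOn_const.integrableOn_compact isCompact_freqBox

lemma acf_one (t : ℤ × ℤ) : acf (fun _ => 1) t = if t = 0 then 1 else 0 := by
  simp only [acf_eq_integral_cos (integrableOn_const_freqBox 1), one_mul, integral_cos_phase]
  split_ifs with ht
  · subst ht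
    have hπ := Real.pi_pos
    simp only [Prod.fst_zero, Prod.snd_zero, Int.cast_zero, zero_mul, Real.cos_zero,
      setIntegral_const, Real.volume_real_Icc_of_le (show -Real.pi ≤ Real.pi by linarith),
      smul_eq_mul]
    field_simp
    ring
  · rcases not_and_or.1 (mt Prod.ext_iff.2 ht) with ht | ht <;> simp [integral_cos_int_mul ht]

lemma site_injective : Function.Injective (site (N := N)) := by
  intro i j h
  simp only [site, Prod.mk.injEq, add_left_inj, Nat.cast_inj] at h
  exact Prod.ext (Fin.ext h.1) (Fin.ext h.2)

lemma covMat_one : covMat N (fun _ => 1) = 1 := by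
  ext i j
  simp only [covMat, of_apply, acf_one, sub_eq_zero, site_injective.eq_iff, one_apply]

lemma covMat_const (c : ℝ) : covMat N (fun _ => c) = c • 1 := by
  simpa only [mul_one, covMat_one] using covMat_const_mul (N := N) c fun _ => 1

-- A lag `t` occurs `(N - |t.1|) (N - |t.2|)` times in the covariance matrix, of the order `N²`, so
-- that a single differing autocovariance already separates the matrices at that order.
lemma exists_lag_pairs (N : ℕ) (h : ℤ) :
    ∃ a b : Fin (N - h.natAbs) → Fin N, Function.Injective a ∧
      ∀ x, ((a x : ℕ) : ℤ) - ((b x : ℕ) : ℤ) = h := by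
  refine ⟨fun x => ⟨x + h.toNat, by omega⟩, fun x => ⟨x + (-h).toNat, by omega⟩,
    fun x y hxy => ?_, fun x => ?_⟩
  · simp only [Fin.mk.injEq] at hxy
    exact Fin.ext (by omega)
  · dsimp only
    omega

lemma mul_sq_acf_sub_le (F G : ℝ × ℝ → ℝ) (t : ℤ × ℤ) (N : ℕ) :
    ((N - t.1.natAbs : ℕ) : ℝ) * ((N - t.2.natAbs : ℕ) : ℝ) * (acf F t - acf G t) ^ 2 ≤
      ∑ i, ∑ j, (covMat N F i j - covMat N G i j) ^ 2 := by
  obtain ⟨a, b, ha, hab⟩ := exists_lag_pairs N t.1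
  obtain ⟨a', b', ha', hab'⟩ := exists_lag_pairs N t.2
  let pair : Fin (N - t.1.natAbs) × Fin (N - t.2.natAbs) → (Fin N × Fin N) × (Fin N × Fin N) :=
    fun x => ((a x.1, a' x.2), (b x.1, b' x.2))
  have hpair : Function.Injective pair := fun x y hxy => by
    simp only [pair, Prod.mk.injEq] at hxy
    exact Prod.ext (ha hxy.1.1) (ha' hxy.1.2)
  have hlag : ∀ x, site (pair x).1 - site (pair x).2 = t := fun x => by
    refine Prod.ext ?_ ?_ <;> simp only [pair, site, Prod.fst_sub, Prod.snd_sub]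
    · linarith [hab x.1]
    · linarith [hab' x.2]
  let sqDiff : (Fin N × Fin N) × (Fin N × Fin N) → ℝ :=
    fun q => (covMat N F q.1 q.2 - covMat N G q.1 q.2) ^ 2
  calc ((N - t.1.natAbs : ℕ) : ℝ) * ((N - t.2.natAbs : ℕ) : ℝ) * (acf F t - acf G t) ^ 2
      = ∑ x, sqDiff (pair x) := by
        simp [sqDiff, covMat, hlag, Fintype.card_prod]
    _ = ∑ q ∈ Finset.univ.image pair, sqDiff q := (Finset.sum_image hpair.injOn).symm
    _ ≤ ∑ q, sqDiff q :=
        Finset.sum_le_sum_of_subset_of_nonneg (Finset.subset_univ _) fun _ _ _ => sq_nonneg _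
    _ = ∑ i, ∑ j, (covMat N F i j - covMat N G i j) ^ 2 := Fintype.sum_prod_type _

lemma exists_mul_sq_le_sum_sq_covMat_sub {t : ℤ × ℤ} (ht : acf F t ≠ acf G t) :
    ∃ d > 0, ∀ᶠ N : ℕ in atTop,
      d * (N : ℝ) ^ 2 ≤ ∑ i, ∑ j, (covMat N F i j - covMat N G i j) ^ 2 := by
  refine ⟨(acf F t - acf G t) ^ 2 / 4, by have := sub_ne_zero.2 ht; positivity, ?_⟩
  filter_upwards [eventually_ge_atTop (2 * (t.1.natAbs + t.2.natAbs))] with N hN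
  have half_le : ∀ m : ℕ, 2 * m ≤ N → (N : ℝ) / 2 ≤ ((N - m : ℕ) : ℝ) := fun m hm => by
    rw [div_le_iff₀ two_pos]
    norm_cast
    omega
  calc (acf F t - acf G t) ^ 2 / 4 * (N : ℝ) ^ 2
      = (N : ℝ) / 2 * (N / 2) * (acf F t - acf G t) ^ 2 := by ring
    _ ≤ ((N - t.1.natAbs : ℕ) : ℝ) * ((N - t.2.natAbs : ℕ) : ℝ) * (acf F t - acf G t) ^ 2 := by
        gcongr
        · exact half_le _ (by omega)
        · exact half_le _ (by omega)
    _ ≤ _ := mul_sq_acf_sub_le F G t N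

lemma SummableSpectrum.eqOn_of_acf_eq (hF : SummableSpectrum F) (hG : SummableSpectrum G)
    (h : ∀ t, acf F t = acf G t) : Set.EqOn F G freqBox := fun w hw => by
  have hsum := hF.hasSum w hw
  simp only [h] at hsum
  exact Complex.ofReal_injective (hsum.unique (hG.hasSum w hw))

end Covariance

section Spectra

/-- A family of positive spectra, jointly continuous in the parameter and the frequency. -/
structure PositiveSpectra {T : Type*} [TopologicalSpace T] (Θ : Set T) (F : T → ℝ × ℝ → ℝ) :
    Prop where
  continuousOn : ContinuousOn (fun q : T × (ℝ × ℝ) => F q.1 q.2) (Θ ×ˢ freqBox)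
  pos : ∀ θ ∈ Θ, ∀ w ∈ freqBox, 0 < F θ w

namespace PositiveSpectra

variable {T : Type*} [TopologicalSpace T] {Θ : Set T} {F : T → ℝ × ℝ → ℝ} {θ : T}

lemma continuousOn_apply (hF : PositiveSpectra Θ F) (hθ : θ ∈ Θ) : ContinuousOn (F θ) freqBox :=
  hF.continuousOn.comp (f := fun w => (θ, w)) (by fun_prop) fun _ hw => ⟨hθ, hw⟩

lemma integrableOn (hF : PositiveSpectra Θ F) (hθ : θ ∈ Θ) : IntegrableOn (F θ) freqBox :=
  (hF.continuousOn_apply hθ).integrableOn_compact isCompact_freqBox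

lemma exists_smul_one_le_covMat (hF : PositiveSpectra Θ F) (hΘ : IsCompact Θ) :
    ∃ c : ℝ, 0 < c ∧ ∀ θ ∈ Θ, ∀ N, c • 1 ≤ covMat N (F θ) := by
  obtain ⟨c, hc, hcF⟩ := (hΘ.prod isCompact_freqBox).exists_forall_le' hF.continuousOn
    (a := 0) fun q hq => hF.pos q.1 hq.1 q.2 hq.2
  refine ⟨c, hc, fun θ hθ N => ?_⟩
  rw [← covMat_const]
  exact covMat_mono (integrableOn_const_freqBox c) (hF.integrableOn hθ)
    fun w hw => hcF (θ, w) ⟨hθ, hw⟩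

lemma exists_covMat_le_smul_one (hF : PositiveSpectra Θ F) (hΘ : IsCompact Θ) :
    ∃ C : ℝ, 0 < C ∧ ∀ θ ∈ Θ, ∀ N, covMat N (F θ) ≤ C • 1 := by
  obtain ⟨C, hC⟩ := (hΘ.prod isCompact_freqBox).exists_bound_of_continuousOn hF.continuousOn
  refine ⟨max C 1, by positivity, fun θ hθ N => ?_⟩
  rw [← covMat_const]
  exact covMat_mono (hF.integrableOn hθ) (integrableOn_const_freqBox _)
    fun w hw => (le_abs_self _).trans ((hC (θ, w) ⟨hθ, hw⟩).trans (le_max_left _ _))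

lemma posDef_covMat (hF : PositiveSpectra Θ F) (hθ : θ ∈ Θ) (N : ℕ) : (covMat N (F θ)).PosDef := by
  obtain ⟨c, hc, hcF⟩ := isCompact_freqBox.exists_forall_le' (hF.continuousOn_apply hθ)
    (hF.pos θ hθ)
  refine posDef_of_smul_one_le hc ?_
  rw [← covMat_const]
  exact covMat_mono (integrableOn_const_freqBox c) (hF.integrableOn hθ) hcF

lemma exists_covMat_le_smul_covMat (hF : PositiveSpectra Θ F) (hΘ : IsCompact Θ) :
    ∃ k : ℝ, 0 < k ∧ ∀ θ ∈ Θ, ∀ θ' ∈ Θ, ∀ N, covMat N (F θ) ≤ k • covMat N (F θ') := by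
  obtain ⟨c, hc, hcF⟩ := hF.exists_smul_one_le_covMat hΘ
  obtain ⟨C, hC, hFC⟩ := hF.exists_covMat_le_smul_one hΘ
  refine ⟨C / c, by positivity, fun θ hθ θ' hθ' N => ?_⟩
  calc covMat N (F θ) ≤ (C / c) • c • (1 : Matrix _ _ ℝ) := by
        rw [smul_smul, div_mul_cancel₀ _ hc.ne']
        exact hFC θ hθ N
    _ ≤ (C / c) • covMat N (F θ') := smul_le_smul_of_nonneg_left (hcF θ' hθ' N) (by positivity)

lemma eventually_covMat_le_smul_covMat (hF : PositiveSpectra Θ F) (hθ : θ ∈ Θ) {s : ℝ}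
    (hs : 0 < s) : ∀ᶠ θ' in 𝓝[Θ] θ, ∀ N, covMat N (F θ) ≤ (1 + s) • covMat N (F θ') ∧
      covMat N (F θ') ≤ (1 + s) • covMat N (F θ) := by
  obtain ⟨c, hc, hcF⟩ := isCompact_freqBox.exists_forall_le' (hF.continuousOn_apply hθ)
    (hF.pos θ hθ)
  have hnear : ∀ᶠ θ' in 𝓝[Θ] θ, ∀ w ∈ freqBox, dist (F θ' w) (F θ w) < s * c / (1 + s) := by
    obtain ⟨v, hv, hvF⟩ := isCompact_freqBox.mem_uniformity_of_prod hF.continuousOn hθ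
      (Metric.dist_mem_uniformity (show 0 < s * c / (1 + s) by positivity))
    exact eventually_of_mem hv hvF
  filter_upwards [hnear, self_mem_nhdsWithin] with θ' hθθ' hθ' N
  have hbound : ∀ w ∈ freqBox, F θ w ≤ (1 + s) * F θ' w ∧ F θ' w ≤ (1 + s) * F θ w := by
    intro w hw
    have hdist := hθθ' w hw
    rw [Real.dist_eq, abs_lt, lt_div_iff₀ (by positivity), neg_lt, lt_div_iff₀ (by positivity)]
      at hdist
    constructor <;> nlinarith [hcF w hw, mul_le_mul_of_nonneg_left (hcF w hw) hs.le]
  exact ⟨covMat_le_smul (hF.integrableOn hθ) (hF.integrableOn hθ') fun w hw => (hbound w hw).1,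
    covMat_le_smul (hF.integrableOn hθ') (hF.integrableOn hθ) fun w hw => (hbound w hw).2⟩

end PositiveSpectra

lemma RegularSpectra.positiveSpectra {p : ℕ} {Θ : Set (EuclideanSpace ℝ (Fin p))}
    {F : EuclideanSpace ℝ (Fin p) → ℝ × ℝ → ℝ} (h : RegularSpectra Θ F) : PositiveSpectra Θ F :=
  ⟨h.continuousOn, fun θ hθ => (h.admissible θ hθ).pos⟩

end Spectra

section Continuity

variable {T : Type*} [TopologicalSpace T] [FirstCountableTopology T] {Θ : Set T}
  {F : T → ℝ × ℝ → ℝ}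

lemma PositiveSpectra.continuousOn_acf (hF : PositiveSpectra Θ F) (hΘ : IsCompact Θ) (t : ℤ × ℤ) :
    ContinuousOn (fun θ => acf (F θ) t) Θ := by
  obtain ⟨C, hC⟩ := (hΘ.prod isCompact_freqBox).exists_bound_of_continuousOn hF.continuousOn
  refine ContinuousOn.congr (continuousOn_const.mul (continuousOn_of_dominated
    (bound := fun _ => C) ?_ ?_ (integrableOn_const_freqBox C) ?_))
    fun θ hθ => acf_eq_integral_cos (hF.integrableOn hθ) t
  · exact fun θ hθ => ((hF.integrableOn hθ).mul_continuousOn (by fun_prop)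
      isCompact_freqBox).aestronglyMeasurable
  · intro θ hθ
    filter_upwards [ae_restrict_mem measurableSet_freqBox] with w hw
    rw [norm_mul]
    exact (mul_le_of_le_one_right (norm_nonneg _) (Real.abs_cos_le_one _)).trans
      (hC (θ, w) ⟨hθ, hw⟩)
  · filter_upwards [ae_restrict_mem measurableSet_freqBox] with w hw
    exact (hF.continuousOn.comp (f := fun θ => (θ, w)) (by fun_prop)
      fun θ hθ => ⟨hθ, hw⟩).mul continuousOn_const

lemma PositiveSpectra.continuousOn_covMat (hF : PositiveSpectra Θ F) (hΘ : IsCompact Θ) (N : ℕ) :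
    ContinuousOn (fun θ => covMat N (F θ)) Θ :=
  continuousOn_pi.2 fun _ => continuousOn_pi.2 fun _ => hF.continuousOn_acf hΘ _

end Continuity

section Regression

variable {Ω : Type*} [MeasurableSpace Ω] {P : Measure Ω} {L : ℕ} {F₀ : ℝ × ℝ → ℝ}
  {X : Fin L → ℤ × ℤ → ℝ} {β₀ : EuclideanSpace ℝ (Fin L)} {Y : ℤ × ℤ → Ω → ℝ}

lemma residual_eq_add (X : Fin L → ℤ × ℤ → ℝ) (N : ℕ) (y : ℤ × ℤ → ℝ)
    (β β' : EuclideanSpace ℝ (Fin L)) :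
    residual X N y β = residual X N y β' + regMat N X *ᵥ (β' - β) := by
  simp only [residual, mulVec_sub]
  abel

/-- A Gaussian field with the mean `∑ β₀ l X l` and the spectrum `F₀`. -/
structure IsGaussianRegression (P : Measure Ω) (F₀ : ℝ × ℝ → ℝ) (X : Fin L → ℤ × ℤ → ℝ)
    (β₀ : EuclideanSpace ℝ (Fin L)) (Y : ℤ × ℤ → Ω → ℝ) : Prop where
  isGaussianProcess : IsGaussianProcess Y P
  integral_eq : ∀ t, ∫ ω, Y t ω ∂P = ∑ l, β₀ l * X l t
  covariance_eq : ∀ s t, cov[Y s, Y t; P] = acf F₀ (t - s)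

lemma IsGaussianRegression.isCenteredGaussian_residual [IsProbabilityMeasure P]
    (hY : IsGaussianRegression P F₀ X β₀ Y) (hF₀ : IntegrableOn F₀ freqBox) (N : ℕ) :
    IsCenteredGaussian P (covMat N F₀) fun ω => residual X N (fun t => Y t ω) β₀ := by
  let coords : (↥(Finset.univ : Finset (Fin N × Fin N)) → ℝ) →L[ℝ] (Fin N × Fin N → ℝ) :=
    ContinuousLinearMap.pi fun i => ContinuousLinearMap.proj ⟨i, Finset.mem_univ i⟩
  have hsample : HasGaussianLaw (fun ω => sample N fun t => Y t ω) P :=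
    ((hY.isGaussianProcess.comp_right (site (N := N))).hasGaussianLaw Finset.univ).map coords
  have hint : ∀ i, Integrable (fun ω => sample N (fun t => Y t ω) i) P := fun i =>
    (HasGaussianLaw.eval (X := fun i ω => sample N (fun t => Y t ω) i) hsample i).integrable
  have hresidual : ∀ ω i, residual X N (fun t => Y t ω) β₀ i =
      sample N (fun t => Y t ω) i - (regMat N X *ᵥ β₀) i := fun ω i => rfl
  refine ⟨⟨?_⟩, fun i => ?_, fun i j => ?_⟩
  · have hmap := AEMeasurable.map_map_of_aemeasurable (μ := P)
      (g := fun v => v - regMat N X *ᵥ β₀) (by fun_prop) hsample.aemeasurable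
    have := hsample.isGaussian_map
    exact hmap ▸ inferInstance
  · have hmean : ∫ ω, sample N (fun t => Y t ω) i ∂P = (regMat N X *ᵥ β₀) i := by
      simp only [sample, hY.integral_eq, mulVec, dotProduct, regMat, of_apply, mul_comm]
    simp only [hresidual]
    rw [integral_sub (hint i) (integrable_const _), hmean, integral_const, probReal_univ, one_smul,
      sub_self]
  · simp only [hresidual]
    rw [covariance_sub_const_left (hint i), covariance_sub_const_right (hint j), covMat, of_apply,
      ← acf_neg hF₀, neg_sub]
    exact hY.covariance_eq _ _

lemma mulVec_dotProduct_mulVec {ι κ : Type*} [Fintype ι] [Fintype κ] (A : Matrix ι ι ℝ)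
    (T : Matrix ι κ ℝ) (v : κ → ℝ) :
    (T *ᵥ v) ⬝ᵥ (A *ᵥ (T *ᵥ v)) = v ⬝ᵥ ((Tᵀ * A * T) *ᵥ v) := by
  rw [Matrix.mul_assoc, ← mulVec_mulVec, ← mulVec_mulVec, dotProduct_mulVec v, vecMul_transpose]

lemma tendsto_inv_dotProduct_regMat {M : Matrix (Fin L) (Fin L) ℝ}
    (hlim : Tendsto (fun N : ℕ => ((N : ℝ) ^ 2)⁻¹ •
      ((regMat N X)ᵀ * (covMat N F₀)⁻¹ * regMat N X)) atTop (𝓝 M)) (v : Fin L → ℝ) :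
    Tendsto (fun N : ℕ => (regMat N X *ᵥ v) ⬝ᵥ ((covMat N F₀)⁻¹ *ᵥ (regMat N X *ᵥ v)) / (N : ℝ) ^ 2)
      atTop (𝓝 (v ⬝ᵥ (M *ᵥ v))) := by
  have hform : Continuous fun A : Matrix (Fin L) (Fin L) ℝ => v ⬝ᵥ (A *ᵥ v) := by fun_prop
  refine ((hform.tendsto M).comp hlim).congr fun N => ?_
  rw [Function.comp_apply, mulVec_dotProduct_mulVec, smul_mulVec, dotProduct_smul, smul_eq_mul,
    inv_mul_eq_div]

lemma exists_regMat_mulVec_dotProduct_self_le {M : Matrix (Fin L) (Fin L) ℝ} {C : ℝ} (hC : 0 < C)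
    (hpd : ∀ N, (covMat N F₀).PosDef) (hFC : ∀ N, covMat N F₀ ≤ C • 1)
    (hlim : Tendsto (fun N : ℕ => ((N : ℝ) ^ 2)⁻¹ •
      ((regMat N X)ᵀ * (covMat N F₀)⁻¹ * regMat N X)) atTop (𝓝 M)) :
    ∃ K ≥ 0, ∀ᶠ N : ℕ in atTop, ∀ b : EuclideanSpace ℝ (Fin L),
      (regMat N X *ᵥ b) ⬝ᵥ (regMat N X *ᵥ b) ≤ K * ‖b‖ ^ 2 * (N : ℝ) ^ 2 := by
  let e : Fin L → Fin L → ℝ := fun l => Pi.single l 1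
  refine ⟨∑ l, C * (|e l ⬝ᵥ (M *ᵥ e l)| + 1), by positivity, ?_⟩
  have hdiag := eventually_all.2 fun l =>
    (tendsto_inv_dotProduct_regMat hlim (e l)).eventually_le_const
      ((le_abs_self _).trans_lt (lt_add_one _))
  filter_upwards [hdiag, eventually_gt_atTop 0] with N hN hN0 b
  have hcol : ∀ l, ∑ i, regMat N X i l ^ 2 ≤ C * (|e l ⬝ᵥ (M *ᵥ e l)| + 1) * (N : ℝ) ^ 2 := by
    intro l
    have hform := hN l
    rw [div_le_iff₀ (by positivity)] at hform
    calc ∑ i, regMat N X i l ^ 2 = (regMat N X *ᵥ e l) ⬝ᵥ (regMat N X *ᵥ e l) := by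
          simp only [e, mulVec_single_one, dotProduct, col_apply, sq]
      _ ≤ C * ((regMat N X *ᵥ e l) ⬝ᵥ ((covMat N F₀)⁻¹ *ᵥ (regMat N X *ᵥ e l))) :=
          dotProduct_self_le_inv (hpd N) (hFC N) _
      _ ≤ C * (|e l ⬝ᵥ (M *ᵥ e l)| + 1) * (N : ℝ) ^ 2 := by
          rw [mul_assoc]
          exact mul_le_mul_of_nonneg_left hform hC.le
  calc (regMat N X *ᵥ b) ⬝ᵥ (regMat N X *ᵥ b)
      ≤ (∑ i, ∑ l, regMat N X i l ^ 2) * (b ⬝ᵥ b) := mulVec_dotProduct_self_le_sum_sq _ _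
    _ ≤ (∑ l, C * (|e l ⬝ᵥ (M *ᵥ e l)| + 1) * (N : ℝ) ^ 2) * (b ⬝ᵥ b) := by
        rw [Finset.sum_comm]
        exact mul_le_mul_of_nonneg_right (Finset.sum_le_sum fun l _ => hcol l)
          (dotProduct_self_nonneg _)
    _ = (∑ l, C * (|e l ⬝ᵥ (M *ᵥ e l)| + 1)) * ‖b‖ ^ 2 * (N : ℝ) ^ 2 := by
        rw [← Finset.sum_mul, EuclideanSpace.real_norm_sq_eq]
        simp only [dotProduct, ← sq]
        ring

end Regression

section Likelihood

variable {p L : ℕ} {Θ : Set (EuclideanSpace ℝ (Fin p))} {F : EuclideanSpace ℝ (Fin p) → ℝ × ℝ → ℝ}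
  {X : Fin L → ℤ × ℤ → ℝ}

lemma PositiveSpectra.continuousOn_logLik (hF : PositiveSpectra Θ F) (hΘ : IsCompact Θ)
    (X : Fin L → ℤ × ℤ → ℝ) (N : ℕ) (y : ℤ × ℤ → ℝ) (B : Set (EuclideanSpace ℝ (Fin L))) :
    ContinuousOn (fun φ : EuclideanSpace ℝ (Fin p) × EuclideanSpace ℝ (Fin L) =>
      logLik F X N y φ.1 φ.2) (Θ ×ˢ B) := by
  have hcov : ContinuousOn (fun φ : EuclideanSpace ℝ (Fin p) × EuclideanSpace ℝ (Fin L) =>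
      covMat N (F φ.1)) (Θ ×ˢ B) :=
    (hF.continuousOn_covMat hΘ N).comp continuousOn_fst fun _ hφ => hφ.1
  have hdet := (continuous_id.matrix_det).comp_continuousOn hcov
  have hdet0 : ∀ φ ∈ Θ ×ˢ B, (covMat N (F φ.1)).det ≠ 0 := fun φ hφ =>
    (hF.posDef_covMat hφ.1 N).det_pos.ne'
  have hinv : ContinuousOn (fun φ : EuclideanSpace ℝ (Fin p) × EuclideanSpace ℝ (Fin L) =>
      (covMat N (F φ.1))⁻¹) (Θ ×ˢ B) := by
    simp only [Matrix.inv_def, Ring.inverse_eq_inv']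
    exact (hdet.inv₀ hdet0).smul ((continuous_id.matrix_adjugate).comp_continuousOn hcov)
  have hres : Continuous fun φ : EuclideanSpace ℝ (Fin p) × EuclideanSpace ℝ (Fin L) =>
      residual X N y φ.2 := by
    unfold residual
    fun_prop
  have hform : Continuous fun q : Matrix (Fin N × Fin N) (Fin N × Fin N) ℝ ×
      (Fin N × Fin N → ℝ) => q.2 ⬝ᵥ (q.1 *ᵥ q.2) := by fun_prop
  exact (continuousOn_const.mul (hdet.log hdet0)).sub (continuousOn_const.mul
    (hform.comp_continuousOn (hinv.prodMk hres.continuousOn)))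

lemma logLik_eq_gaussianLogLik (N : ℕ) (y : ℤ × ℤ → ℝ) (θ : EuclideanSpace ℝ (Fin p))
    (β : EuclideanSpace ℝ (Fin L)) :
    logLik F X N y θ β = gaussianLogLik (covMat N (F θ)) (residual X N y β) := rfl

lemma posteriorExp_eq_integral_tilted {E : Type*} [NormedAddCommGroup E] [NormedSpace ℝ E]
    (F : EuclideanSpace ℝ (Fin p) → ℝ × ℝ → ℝ) (X : Fin L → ℤ × ℤ → ℝ)
    (prior : Measure (EuclideanSpace ℝ (Fin p) × EuclideanSpace ℝ (Fin L))) (N : ℕ)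
    (y : ℤ × ℤ → ℝ) (g : EuclideanSpace ℝ (Fin p) × EuclideanSpace ℝ (Fin L) → E) :
    posteriorExp F X prior N y g =
      ∫ φ, g φ ∂(prior.tilted fun φ => logLik F X N y φ.1 φ.2) := by
  simp only [posteriorExp, integral_tilted, div_eq_inv_mul, mul_smul, integral_smul]

end Likelihood

section Asymptotics

variable {Ω : Type*} [MeasurableSpace Ω] {P : Measure Ω} [IsProbabilityMeasure P] {p L : ℕ}
  {Θ : Set (EuclideanSpace ℝ (Fin p))} {B : Set (EuclideanSpace ℝ (Fin L))}
  {F : EuclideanSpace ℝ (Fin p) → ℝ × ℝ → ℝ} {X : Fin L → ℤ × ℤ → ℝ} {Y : ℤ × ℤ → Ω → ℝ}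
  {θ₀ θ : EuclideanSpace ℝ (Fin p)} {β₀ : EuclideanSpace ℝ (Fin L)}
  {M : Matrix (Fin L) (Fin L) ℝ}

lemma PositiveSpectra.exists_mul_sq_le_gaussianKL (hF : PositiveSpectra Θ F) (hΘ : IsCompact Θ)
    (hθ₀ : θ₀ ∈ Θ) (hθ : θ ∈ Θ) {t : ℤ × ℤ} (ht : acf (F θ₀) t ≠ acf (F θ) t) :
    ∃ δ > 0, ∀ᶠ N : ℕ in atTop, ∀ g,
      δ * (N : ℝ) ^ 2 ≤ gaussianKL (covMat N (F θ₀)) (covMat N (F θ)) g := by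
  obtain ⟨d, hd, hdN⟩ := exists_mul_sq_le_sum_sq_covMat_sub ht
  obtain ⟨C, hC, hFC⟩ := hF.exists_covMat_le_smul_one hΘ
  obtain ⟨k, hk, hFk⟩ := hF.exists_covMat_le_smul_covMat hΘ
  refine ⟨d / (4 * (C * k) ^ 2 * (k + 1)), by positivity, ?_⟩
  filter_upwards [hdN] with N hN g
  rw [div_mul_eq_mul_div, div_le_iff₀' (by positivity)]
  exact hN.trans (sum_sq_sub_le_gaussianKL (hF.posDef_covMat hθ₀ N) (hF.posDef_covMat hθ N) hC.le
    (hFC θ₀ hθ₀ N) hk.le (hFk θ₀ hθ₀ θ hθ N) (hFk θ hθ θ₀ hθ₀ N) g)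

lemma exists_mul_sq_le_gaussianKL_regMat {F₀ : ℝ × ℝ → ℝ} (hpd : ∀ N, (covMat N F₀).PosDef)
    (hM : M.PosDef)
    (hlim : Tendsto (fun N : ℕ => ((N : ℝ) ^ 2)⁻¹ •
      ((regMat N X)ᵀ * (covMat N F₀)⁻¹ * regMat N X)) atTop (𝓝 M))
    {v : Fin L → ℝ} (hv : v ≠ 0) :
    ∃ δ > 0, ∀ᶠ N : ℕ in atTop,
      δ * (N : ℝ) ^ 2 ≤ gaussianKL (covMat N F₀) (covMat N F₀) (regMat N X *ᵥ v) := by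
  have hpos : 0 < v ⬝ᵥ (M *ᵥ v) := by simpa using hM.dotProduct_mulVec_pos hv
  refine ⟨1 / 2 * (v ⬝ᵥ (M *ᵥ v) / 2), by positivity, ?_⟩
  filter_upwards [(tendsto_inv_dotProduct_regMat hlim v).eventually_const_le (half_lt_self hpos),
    eventually_gt_atTop 0] with N hN hN0
  rw [le_div_iff₀ (by positivity)] at hN
  rw [mul_assoc]
  exact (mul_le_mul_of_nonneg_left hN (by norm_num)).trans
    (half_inv_dotProduct_le_gaussianKL (hpd N) (hpd N) _)

lemma exists_mul_sq_le_gaussianKL (hF : PositiveSpectra Θ F) (hΘ : IsCompact Θ) (hθ₀ : θ₀ ∈ Θ)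
    (hid : ∀ θ ∈ Θ, (∀ t, acf (F θ) t = acf (F θ₀) t) → θ = θ₀) (hM : M.PosDef)
    (hlim : Tendsto (fun N : ℕ => ((N : ℝ) ^ 2)⁻¹ •
      ((regMat N X)ᵀ * (covMat N (F θ₀))⁻¹ * regMat N X)) atTop (𝓝 M))
    {φ : EuclideanSpace ℝ (Fin p) × EuclideanSpace ℝ (Fin L)} (hφ : φ.1 ∈ Θ)
    (hne : φ ≠ (θ₀, β₀)) :
    ∃ δ > 0, ∀ᶠ N : ℕ in atTop, δ * (N : ℝ) ^ 2 ≤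
      gaussianKL (covMat N (F θ₀)) (covMat N (F φ.1)) (regMat N X *ᵥ (β₀ - φ.2)) := by
  by_cases hθ : φ.1 = θ₀
  · have hβ : (β₀ - φ.2).ofLp ≠ 0 := fun h =>
      hne (Prod.ext hθ (sub_eq_zero.1 (WithLp.ofLp_injective 2 h)).symm)
    rw [hθ]
    exact exists_mul_sq_le_gaussianKL_regMat (hF.posDef_covMat hθ₀) hM hlim hβ
  · obtain ⟨t, ht⟩ := not_forall.1 (mt (hid φ.1 hφ) hθ)
    obtain ⟨δ, hδ, hN⟩ := hF.exists_mul_sq_le_gaussianKL hΘ hθ₀ hφ (Ne.symm ht)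
    exact ⟨δ, hδ, hN.mono fun N hN => hN _⟩

lemma tendsto_const_div_sq (K : ℝ) : Tendsto (fun N : ℕ => K / (N : ℝ) ^ 2) atTop (𝓝 0) :=
  (tendsto_const_div_pow K 2 two_ne_zero).comp tendsto_natCast_atTop_atTop

lemma withHighProb_logLik_sub_le (hF : PositiveSpectra Θ F) (hΘ : IsCompact Θ) (hθ₀ : θ₀ ∈ Θ)
    (hY : IsGaussianRegression P (F θ₀) X β₀ Y)
    (hlim : Tendsto (fun N : ℕ => ((N : ℝ) ^ 2)⁻¹ •
      ((regMat N X)ᵀ * (covMat N (F θ₀))⁻¹ * regMat N X)) atTop (𝓝 M))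
    (hθ : θ ∈ Θ) (β : EuclideanSpace ℝ (Fin L)) {s : ℝ} (hs : 0 < s) :
    WithHighProb P atTop fun N ω =>
      logLik F X N (fun t => Y t ω) θ β - logLik F X N (fun t => Y t ω) θ₀ β₀ ≤
        s * (N : ℝ) ^ 2 -
          gaussianKL (covMat N (F θ₀)) (covMat N (F θ)) (regMat N X *ᵥ (β₀ - β)) := by
  obtain ⟨c, hc, hcF⟩ := hF.exists_smul_one_le_covMat hΘ
  obtain ⟨C, hC, hFC⟩ := hF.exists_covMat_le_smul_one hΘ
  obtain ⟨k, hk, hFk⟩ := hF.exists_covMat_le_smul_covMat hΘ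
  obtain ⟨K, -, hXK⟩ := exists_regMat_mulVec_dotProduct_self_le hC (hF.posDef_covMat hθ₀)
    (hFC θ₀ hθ₀) hlim
  refine .of_measure_le (tendsto_const_div_sq
    ((chiSqVar * (1 + k) ^ 2 + k * (c⁻¹ * (K * ‖β₀ - β‖ ^ 2))) / s ^ 2)) ?_
  filter_upwards [hXK, eventually_gt_atTop 0] with N hKN hN
  have hres := hY.isCenteredGaussian_residual (hF.integrableOn hθ₀) N
  refine (measure_mono fun ω hω => ?_).trans ((hres.measure_le_abs_gaussianLogLik_sub_le
    (hF.posDef_covMat hθ₀ N) (hF.posDef_covMat hθ N) (hFk θ₀ hθ₀ θ hθ N)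
    (regMat N X *ᵥ (β₀ - β)) (s := s * (N : ℝ) ^ 2) (by positivity)).trans
    (ENNReal.ofReal_le_ofReal ?_))
  · simp only [Set.mem_ofPred_eq, not_le] at hω ⊢
    rw [logLik_eq_gaussianLogLik, logLik_eq_gaussianLogLik, residual_eq_add X N _ β β₀] at hω
    exact (by linarith : s * (N : ℝ) ^ 2 ≤ _).trans (le_abs_self _)
  · have hmean := inv_dotProduct_le_of_smul_one_le hc (hcF θ hθ N) (regMat N X *ᵥ (β₀ - β))
    have hcard : (Fintype.card (Fin N × Fin N) : ℝ) = (N : ℝ) ^ 2 := by simp [sq]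
    rw [hcard, div_div, div_le_div_iff₀ (by positivity) (by positivity)]
    calc _ ≤ (chiSqVar * ((1 + k) ^ 2 * (N : ℝ) ^ 2) +
          k * (c⁻¹ * (K * ‖β₀ - β‖ ^ 2 * (N : ℝ) ^ 2))) * (s ^ 2 * (N : ℝ) ^ 2) := by
          gcongr
          exact hmean.trans (mul_le_mul_of_nonneg_left (hKN (β₀ - β)) (by positivity))
      _ = _ := by ring

lemma withHighProb_residual_dotProduct_self_le {F₀ : ℝ × ℝ → ℝ} {C : ℝ} (hC : 0 < C)
    (hF₀ : IntegrableOn F₀ freqBox) (hpd : ∀ N, (covMat N F₀).PosDef)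
    (hFC : ∀ N, covMat N F₀ ≤ C • 1) (hY : IsGaussianRegression P F₀ X β₀ Y) :
    WithHighProb P atTop fun N ω =>
      residual X N (fun t => Y t ω) β₀ ⬝ᵥ residual X N (fun t => Y t ω) β₀ ≤
        2 * C * (N : ℝ) ^ 2 := by
  refine .of_measure_le (tendsto_const_div_sq chiSqVar) ?_
  filter_upwards [eventually_gt_atTop 0] with N hN
  have hcard : (Fintype.card (Fin N × Fin N) : ℝ) = (N : ℝ) ^ 2 := by simp [sq]
  have hcheb := (hY.isCenteredGaussian_residual hF₀ N).measure_le_dotProduct_self_le (hpd N) hC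
    (hFC N) (s := (N : ℝ) ^ 2) (by positivity)
  rw [hcard] at hcheb
  refine (measure_mono fun ω hω => ?_).trans (hcheb.trans_eq ?_)
  · simp only [Set.mem_ofPred_eq, not_le] at hω ⊢
    linarith
  · congr 1
    field_simp

lemma logLik_sub_le {c s : ℝ} (hc : 0 < c) (hs : 0 < s) {N : ℕ} {θ' : EuclideanSpace ℝ (Fin p)}
    (hcθ : c • 1 ≤ covMat N (F θ)) (hcθ' : c • 1 ≤ covMat N (F θ'))
    (hle : covMat N (F θ) ≤ (1 + s) • covMat N (F θ'))
    (hge : covMat N (F θ') ≤ (1 + s) • covMat N (F θ)) (y : ℤ × ℤ → ℝ)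
    (β β' : EuclideanSpace ℝ (Fin L)) :
    logLik F X N y θ' β' - logLik F X N y θ β ≤
      1 / 2 * s * (N : ℝ) ^ 2 + s * (c⁻¹ * (residual X N y β ⬝ᵥ residual X N y β)) +
        1 / 2 * s⁻¹ * (c⁻¹ * ((regMat N X *ᵥ (β - β')) ⬝ᵥ (regMat N X *ᵥ (β - β')))) := by
  have hcard : (Fintype.card (Fin N × Fin N) : ℝ) = (N : ℝ) ^ 2 := by simp [sq]
  rw [logLik_eq_gaussianLogLik, logLik_eq_gaussianLogLik, residual_eq_add X N y β' β, ← hcard]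
  refine (gaussianLogLik_sub_le (posDef_of_smul_one_le hc hcθ) (posDef_of_smul_one_le hc hcθ') hs
    hle hge _ _).trans ?_
  gcongr <;> exact inv_dotProduct_le_of_smul_one_le hc hcθ _

lemma exists_withHighProb_forall_residual_dotProduct_self_le (hF : PositiveSpectra Θ F)
    (hΘ : IsCompact Θ) (hB : Bornology.IsBounded B) (hθ₀ : θ₀ ∈ Θ)
    (hY : IsGaussianRegression P (F θ₀) X β₀ Y)
    (hlim : Tendsto (fun N : ℕ => ((N : ℝ) ^ 2)⁻¹ •
      ((regMat N X)ᵀ * (covMat N (F θ₀))⁻¹ * regMat N X)) atTop (𝓝 M)) :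
    ∃ R ≥ 0, WithHighProb P atTop fun N ω => ∀ β ∈ B,
      residual X N (fun t => Y t ω) β ⬝ᵥ residual X N (fun t => Y t ω) β ≤ R * (N : ℝ) ^ 2 := by
  obtain ⟨C, hC, hFC⟩ := hF.exists_covMat_le_smul_one hΘ
  obtain ⟨K, hK, hXK⟩ := exists_regMat_mulVec_dotProduct_self_le hC (hF.posDef_covMat hθ₀)
    (hFC θ₀ hθ₀) hlim
  obtain ⟨D, hD⟩ := hB.subset_closedBall β₀
  refine ⟨2 * (2 * C) + 2 * (K * D ^ 2), by positivity,
    (withHighProb_residual_dotProduct_self_le hC (hF.integrableOn hθ₀) (hF.posDef_covMat hθ₀)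
      (hFC θ₀ hθ₀) hY).mono ?_⟩
  filter_upwards [hXK] with N hKN ω hω β hβ
  have hβD : ‖β₀ - β‖ ≤ D := by simpa [dist_eq_norm'] using hD hβ
  rw [residual_eq_add X N _ β β₀]
  calc _ ≤ 2 * (residual X N (fun t => Y t ω) β₀ ⬝ᵥ residual X N (fun t => Y t ω) β₀) +
        2 * ((regMat N X *ᵥ (β₀ - β)) ⬝ᵥ (regMat N X *ᵥ (β₀ - β))) := dotProduct_add_self_le _ _
    _ ≤ 2 * (2 * C * (N : ℝ) ^ 2) + 2 * (K * D ^ 2 * (N : ℝ) ^ 2) := by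
        gcongr
        exact (hKN (β₀ - β)).trans (by gcongr)
    _ = _ := by ring

lemma exists_withHighProb_forall_logLik_sub_le (hF : PositiveSpectra Θ F) (hΘ : IsCompact Θ)
    (hB : Bornology.IsBounded B) (hθ₀ : θ₀ ∈ Θ) (hY : IsGaussianRegression P (F θ₀) X β₀ Y)
    (hlim : Tendsto (fun N : ℕ => ((N : ℝ) ^ 2)⁻¹ •
      ((regMat N X)ᵀ * (covMat N (F θ₀))⁻¹ * regMat N X)) atTop (𝓝 M)) :
    ∃ K > 0, WithHighProb P atTop fun N ω =>
      ∀ θ ∈ Θ, ∀ θ' ∈ Θ, ∀ β ∈ B, ∀ β' : EuclideanSpace ℝ (Fin L), ∀ s > 0,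
        covMat N (F θ) ≤ (1 + s) • covMat N (F θ') → covMat N (F θ') ≤ (1 + s) • covMat N (F θ) →
        logLik F X N (fun t => Y t ω) θ' β' - logLik F X N (fun t => Y t ω) θ β ≤
          K * (s + s⁻¹ * ‖β - β'‖ ^ 2) * (N : ℝ) ^ 2 := by
  obtain ⟨c, hc, hcF⟩ := hF.exists_smul_one_le_covMat hΘ
  obtain ⟨C, hC, hFC⟩ := hF.exists_covMat_le_smul_one hΘ
  obtain ⟨K, hK, hXK⟩ := exists_regMat_mulVec_dotProduct_self_le hC (hF.posDef_covMat hθ₀)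
    (hFC θ₀ hθ₀) hlim
  obtain ⟨R, hR, hres⟩ :=
    exists_withHighProb_forall_residual_dotProduct_self_le hF hΘ hB hθ₀ hY hlim
  refine ⟨1 / 2 + c⁻¹ * R + 1 / 2 * (c⁻¹ * K), by positivity, hres.mono ?_⟩
  filter_upwards [hXK] with N hKN ω hω θ hθ θ' hθ' β hβ β' s hs hle hge
  have hcK : 0 ≤ 1 / 2 * (c⁻¹ * K) := by positivity
  have hcR : 0 ≤ 1 / 2 + c⁻¹ * R := by positivity
  calc _ ≤ 1 / 2 * s * (N : ℝ) ^ 2 + s * (c⁻¹ * (R * (N : ℝ) ^ 2)) +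
        1 / 2 * s⁻¹ * (c⁻¹ * (K * ‖β - β'‖ ^ 2 * (N : ℝ) ^ 2)) := by
        refine (logLik_sub_le hc hs (hcF θ hθ N) (hcF θ' hθ' N) hle hge _ β β').trans ?_
        gcongr
        exacts [hω β hβ, hKN (β - β')]
    _ = ((1 / 2 + c⁻¹ * R) * s + 1 / 2 * (c⁻¹ * K) * (s⁻¹ * ‖β - β'‖ ^ 2)) * (N : ℝ) ^ 2 := by ring
    _ ≤ (1 / 2 + c⁻¹ * R + 1 / 2 * (c⁻¹ * K)) * (s + s⁻¹ * ‖β - β'‖ ^ 2) * (N : ℝ) ^ 2 := by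
        rw [mul_add]
        exact mul_le_mul_of_nonneg_right (add_le_add
          (mul_le_mul_of_nonneg_right (le_add_of_nonneg_right hcK) (by positivity))
          (mul_le_mul_of_nonneg_right (le_add_of_nonneg_left hcR) (by positivity)))
          (by positivity)

lemma exists_withHighProb_abs_logLik_sub_le (hF : PositiveSpectra Θ F) (hΘ : IsCompact Θ)
    (hB : Bornology.IsBounded B) (hθ₀ : θ₀ ∈ Θ) (hY : IsGaussianRegression P (F θ₀) X β₀ Y)
    (hlim : Tendsto (fun N : ℕ => ((N : ℝ) ^ 2)⁻¹ •
      ((regMat N X)ᵀ * (covMat N (F θ₀))⁻¹ * regMat N X)) atTop (𝓝 M))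
    {φ : EuclideanSpace ℝ (Fin p) × EuclideanSpace ℝ (Fin L)} (hφ : φ ∈ Θ ×ˢ B) {η : ℝ}
    (hη : 0 < η) :
    ∃ V ∈ 𝓝[Θ ×ˢ B] φ, WithHighProb P atTop fun N ω => ∀ ψ ∈ V,
      |logLik F X N (fun t => Y t ω) ψ.1 ψ.2 - logLik F X N (fun t => Y t ω) φ.1 φ.2| ≤
        η * (N : ℝ) ^ 2 := by
  obtain ⟨K, hK, hsub⟩ := exists_withHighProb_forall_logLik_sub_le hF hΘ hB hθ₀ hY hlim
  obtain ⟨s, hs, hKs⟩ : ∃ s > 0, K * (s + s) = η :=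
    ⟨η / (2 * K), by positivity, by field_simp; ring⟩
  have hfst : Tendsto Prod.fst (𝓝[Θ ×ˢ B] φ) (𝓝[Θ] φ.1) :=
    continuousWithinAt_fst.tendsto_nhdsWithin fun _ hψ => hψ.1
  have hsnd : ∀ᶠ ψ in 𝓝[Θ ×ˢ B] φ, ‖φ.2 - ψ.2‖ < s :=
    (Continuous.tendsto' (by fun_prop) φ 0 (by simp)).mono_left nhdsWithin_le_nhds
      |>.eventually_lt_const hs
  refine ⟨_, (hfst.eventually (hF.eventually_covMat_le_smul_covMat hφ.1 hs)).and
    (hsnd.and self_mem_nhdsWithin), hsub.mono (Eventually.of_forall fun N ω hω ψ hψ => ?_)⟩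
  obtain ⟨hcov, hψs, hψ⟩ := hψ
  have hbound : K * (s + s⁻¹ * ‖φ.2 - ψ.2‖ ^ 2) * (N : ℝ) ^ 2 ≤ η * (N : ℝ) ^ 2 := by
    rw [← hKs]
    gcongr
    calc s⁻¹ * ‖φ.2 - ψ.2‖ ^ 2 ≤ s⁻¹ * s ^ 2 := by gcongr
      _ = s := by field_simp
  have hup := hω φ.1 hφ.1 ψ.1 hψ.1 φ.2 hφ.2 ψ.2 s hs (hcov N).1 (hcov N).2
  have hdown := hω ψ.1 hψ.1 φ.1 hφ.1 ψ.2 hψ.2 φ.2 s hs (hcov N).2 (hcov N).1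
  rw [norm_sub_rev] at hdown
  exact abs_sub_le_iff.2 ⟨hup.trans hbound, hdown.trans hbound⟩

theorem peaksAt_logLik (hF : PositiveSpectra Θ F) (hΘ : IsCompact Θ)
    (hB : Bornology.IsBounded B) (hθ₀ : θ₀ ∈ Θ)
    (hid : ∀ θ ∈ Θ, (∀ t, acf (F θ) t = acf (F θ₀) t) → θ = θ₀)
    (hY : IsGaussianRegression P (F θ₀) X β₀ Y) (hM : M.PosDef)
    (hlim : Tendsto (fun N : ℕ => ((N : ℝ) ^ 2)⁻¹ •
      ((regMat N X)ᵀ * (covMat N (F θ₀))⁻¹ * regMat N X)) atTop (𝓝 M)) :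
    PeaksAt P atTop (fun N : ℕ => (N : ℝ) ^ 2) (Θ ×ˢ B) (θ₀, β₀)
      fun N ω φ => logLik F X N (fun t => Y t ω) φ.1 φ.2 where
  continuousOn N ω := hF.continuousOn_logLik hΘ X N _ B
  exists_le_sub φ hφ hne := by
    obtain ⟨δ, hδ, hKL⟩ := exists_mul_sq_le_gaussianKL hF hΘ hθ₀ hid hM hlim hφ.1 hne
    refine ⟨δ / 2, half_pos hδ, (withHighProb_logLik_sub_le hF hΘ hθ₀ hY hlim hφ.1 φ.2
      (half_pos hδ)).mono ?_⟩
    filter_upwards [hKL] with N hN ω hω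
    linarith
  exists_abs_sub_le _ hφ _ hη :=
    exists_withHighProb_abs_logLik_sub_le hF hΘ hB hθ₀ hY hlim hφ hη

end Asymptotics

end LatticeField

end

theorem mainTheorem2_general {Ω : Type*} [MeasurableSpace Ω] (P : Measure Ω)
    [IsProbabilityMeasure P] {p L : ℕ}
    (Θ : Set (EuclideanSpace ℝ (Fin p))) (B : Set (EuclideanSpace ℝ (Fin L)))
    (hΘ : IsCompact Θ) (hB : IsCompact B)
    (F : EuclideanSpace ℝ (Fin p) → ℝ × ℝ → ℝ) (hF : LatticeField.PositiveSpectra Θ F)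
    (θ₀ : EuclideanSpace ℝ (Fin p)) (β₀ : EuclideanSpace ℝ (Fin L))
    (hθ₀ : θ₀ ∈ Θ) (hβ₀ : β₀ ∈ B)
    (hid : ∀ θ ∈ Θ, (∀ t, LatticeField.acf (F θ) t = LatticeField.acf (F θ₀) t) → θ = θ₀)
    (X : Fin L → ℤ × ℤ → ℝ) (Y : ℤ × ℤ → Ω → ℝ)
    (hY : LatticeField.IsGaussianRegression P (F θ₀) X β₀ Y)
    (M : Matrix (Fin L) (Fin L) ℝ)
    (hlim : Tendsto (fun N : ℕ => ((N : ℝ) ^ 2)⁻¹ • ((LatticeField.regMat N X).transpose *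
      (LatticeField.covMat N (F θ₀))⁻¹ * LatticeField.regMat N X)) atTop (𝓝 M))
    (hM : M.PosDef)
    (prior : Measure (EuclideanSpace ℝ (Fin p) × EuclideanSpace ℝ (Fin L)))
    [IsFiniteMeasure prior] (hprior : ∀ᵐ φ ∂prior, φ ∈ Θ ×ˢ B)
    (hprior₀ : ∀ U ∈ 𝓝 (θ₀, β₀), 0 < prior U)
    {E : Type*} [NormedAddCommGroup E] [NormedSpace ℝ E] [CompleteSpace E]
    (g : EuclideanSpace ℝ (Fin p) × EuclideanSpace ℝ (Fin L) → E) (hg : ContinuousOn g (Θ ×ˢ B)) :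
    TendstoInMeasure P
      (fun (N : ℕ) ω => LatticeField.posteriorExp F X prior N (fun t => Y t ω) g)
      atTop (fun _ => g (θ₀, β₀)) := by
  have hpeak := LatticeField.peaksAt_logLik hF hΘ hB.isBounded hθ₀ hid hY hM hlim
  have hrate : Tendsto (fun N : ℕ => (N : ℝ) ^ 2) atTop atTop :=
    (tendsto_pow_atTop two_ne_zero).comp tendsto_natCast_atTop_atTop
  simp only [LatticeField.posteriorExp_eq_integral_tilted]
  exact hpeak.tendstoInMeasure_integral_tilted hrate (hΘ.prod hB) ⟨hθ₀, hβ₀⟩ hprior hprior₀ hg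

theorem mainTheorem2 {Ω : Type*} [MeasurableSpace Ω] (P : Measure Ω) [IsProbabilityMeasure P]
    {p L : ℕ}
    -- the compact parameter space `Θ × B` and the family of spectra
    (Θ : Set (EuclideanSpace ℝ (Fin p))) (B : Set (EuclideanSpace ℝ (Fin L)))
    (hΘ : IsCompact Θ) (hB : IsCompact B)
    (F : EuclideanSpace ℝ (Fin p) → ℝ × ℝ → ℝ)
    (hA2 : LatticeField.RegularSpectra Θ F) (hid : LatticeField.Identifiable Θ F)
    -- the true parameters
    (θ₀ : EuclideanSpace ℝ (Fin p)) (β₀ : EuclideanSpace ℝ (Fin L))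
    (hθ₀ : θ₀ ∈ interior Θ) (hβ₀ : β₀ ∈ interior B)
    -- the Gaussian data field, with correctly specified regressors and spectrum
    (X : Fin L → ℤ × ℤ → ℝ) (Y : ℤ × ℤ → Ω → ℝ)
    (hgauss : IsGaussianProcess Y P)
    (hmean : ∀ t, ∫ ω, Y t ω ∂P = ∑ l, β₀ l * X l t)
    (hcov : ∀ s t, cov[Y s, Y t; P] = LatticeField.acf (F θ₀) (t - s))
    -- the condition on the regression matrix
    (M : EuclideanSpace ℝ (Fin p) → Matrix (Fin L) (Fin L) ℝ)
    (hlim : ∀ θ ∈ Θ, Tendsto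
      (fun N : ℕ => ((N : ℝ) ^ 2)⁻¹ •
        ((LatticeField.regMat N X).transpose * (LatticeField.covMat N (F θ))⁻¹ * LatticeField.regMat N X))
      atTop (𝓝 (M θ)))
    (hpos : ∀ θ ∈ Θ, (M θ).PosDef)
    (hM : ∃ lo hi : ℝ, 0 < lo ∧ ∀ θ ∈ Θ, spectrum ℝ (M θ) ⊆ Set.Icc lo hi)
    -- the prior: a law on the parameter space that charges every neighbourhood of the truth
    (prior : Measure (EuclideanSpace ℝ (Fin p) × EuclideanSpace ℝ (Fin L)))
    [IsProbabilityMeasure prior]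
    (hprior : ∀ᵐ φ ∂prior, φ ∈ Θ ×ˢ B)
    (hprior₀ : ∀ U ∈ 𝓝 (θ₀, β₀), 0 < prior U) :
    TendstoInMeasure P
        (fun (N : ℕ) ω => LatticeField.posteriorExp F X prior N (fun t => Y t ω) Prod.snd)
        atTop (fun _ => β₀) ∧
      TendstoInMeasure P
        (fun (N : ℕ) ω => LatticeField.posteriorExp F X prior N (fun t => Y t ω) Prod.fst)
        atTop (fun _ => θ₀) := by
  have hθ₀Θ := interior_subset hθ₀
  have hidΘ : ∀ θ ∈ Θ, (∀ t, LatticeField.acf (F θ) t = LatticeField.acf (F θ₀) t) → θ = θ₀ :=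
    fun θ hθ hacf => hid θ hθ θ₀ hθ₀Θ
      ((hA2.admissible θ hθ).summable.eqOn_of_acf_eq (hA2.admissible θ₀ hθ₀Θ).summable hacf)
  have hconsistent {E : Type} [NormedAddCommGroup E] [NormedSpace ℝ E] [CompleteSpace E] :=
    mainTheorem2_general (E := E) P Θ B hΘ hB F hA2.positiveSpectra θ₀ β₀ hθ₀Θ
      (interior_subset hβ₀) hidΘ X Y ⟨hgauss, hmean, hcov⟩ (M θ₀) (hlim θ₀ hθ₀Θ) (hpos θ₀ hθ₀Θ)
      prior hprior hprior₀
  exact ⟨hconsistent Prod.snd continuous_snd.continuousOn,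
    hconsistent Prod.fst continuous_fst.continuousOn⟩
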